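/- **Hyperfields.** A canonical abelian hypergroup is a set $H$ with an operation $+:H\times H\to 2^H$ such that (extending $+$ to subsets by unions) $(x+y)+z=x+(y+z)$, $x+y=y+x$, there is $0\in H$ with $x+0=\{x\}$ for all $x$, for each $x$ there is a unique $-x$ with $0\in x+(-x)$, and $x\in y-z\iff y\in x+z$. A hyperfield is a canonical abelian hypergroup with a commutative, associative, unital multiplication $H\times H\to H$ such that $(x+y)z\subseteq xz+yz$, $0\ne 1$, and every nonzero element is invertible. It is a field if all sums $x+y$ are one-element sets. A valued hyperfield (Krasner) is a hyperfield $H$ with a map $|\cdot|:H\to\mathbb R$ such that: (i) $|x|\ge 0$, with equality iff $x=0$; (ii) $|xy|=|x||y|$; (iii) $|z|\le\max(|x|,|y|)$ for $z\in x+y$; (iv) if $0\notin x+y$, all elements of $x+y$ have the same absolute value (so $d(x,y)=|x-y|$ for $x\neq y$, $d(x,x)=0$, defines a metric); (v) there is a real $\rho>0$ such that either $x+y$ is a closed ball of radius $\rho\max(|x|,|y|)$ for all $x,y$, or $x+y$ is an open ball of radius $\rho\max(|x|,|y|)$ for all $(x,y)\ne(0,0)$. It is discretely valued if $0$ is the only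 non-isolated point of the image of $|\cdot|$. For a discretely valued hyperfield $H$ that is not a field, let $\rho_H$ be the smallest $\rho$ as in (v), let $\theta_H$ be the largest absolute value less than $1$ of a nonzero element, put $\mathcal O_H=\{x: |x|\le 1\}$ and $\mathfrak m_H^k=\{x:|x|\le\theta_H^k\}$, write $x\equiv_\eta y$ for $d(x,y)\le\eta$, and call $\pi\in H$ a uniformizer if $|\pi|=\theta_H$. A homomorphism $f:H_1\to H_2$ of valued hyperfields is a map with $f(xy)=f(x)f(y)$, with $f^{-1}(a+b)=f^{-1}(a)+f^{-1}(b)$ for all $a,b\in f(H_1)$, with $|f(x)|=|x|$, and such that $f^{-1}(1)$ is a ball. **Triples.** A triple (Deligne) $(R,M,\epsilon)$ consists of a commutative local Artinian ring $R$ with principal maximal ideal $\mathfrak m_R$, a free $R$-module $M$ of rank $1$, and an $R$-linear map $\epsilon:M\to R$ with image $\mathfrak m_R$. Let $\epsilon_{0,r}:M^{\otimes r}\to R$ be the linear map with $\epsilon_{0,r}(x_1\otimes\cdots\otimes x_r)=\epsilon(x_1)\cdots\epsilon(x_r)$. A morphism $(R,M,\epsilon)\to(R',M',\epsilon')$ is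 a triple $(r,\phi,\eta)$ of an integer $r\ge 1$, a ring homomorphism $\phi:R\to R'$ and an $R$-linear map $\eta:M\to M'^{\otimes r}$ such that $\phi\epsilon=\epsilon'_{0,r}\eta$ and such that the induced map $M\otimes_R R'\to M'^{\otimes r}$ is an isomorphism. Composition is $(r,\phi,\eta)(s,\psi,\theta)=(rs,\phi\psi,\eta^{\otimes s}\theta)$. **Theorem.** There is a functor $\mathrm{Tr}$ from the category of discretely valued hyperfields which are not fields to the category of triples with the following properties. 1. $\mathrm{Tr}(H)=(R,M,\epsilon)$ with $R=\mathcal O_H/\!\equiv_{\rho_H}$ and $M=\mathfrak m_H/\!\equiv_{\theta_H\rho_H}$ (up to identification of sets along given reduction maps), where the sum of two classes is the class of any element of the sum of representatives, products and scalar products are computed on representatives, and $\epsilon$ sends the class of $x\in\mathfrak m_H$ to the class of $x$ in $R$. 2. For a homomorphism $f:H\to H'$ with $\mathrm{Tr}(H')=(R',M',\epsilon')$, one has $\mathrm{Tr}(f)=(r,\phi,\eta)$ with $r=\log\theta_H/\log\theta_{H'}$; $\phi$ sends the class of $x$ to the class of $f(x)$; and if $x\in\mathfrak m_H$ and $f(x)=u\pi'^r$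 with $u\in\mathcal O_{H'}$ and $\pi'$ a uniformizer of $H'$, then $\eta$ sends the class of $x$ to $[u]\,[\pi']^{\otimes r}$ (i.e. to the class of $f(x)$ in $\mathfrak m_{H'}^r/\!\equiv_{\rho_{H'}\theta_{H'}^r}\;\cong M'^{\otimes r}$). 3. $\mathrm{Tr}$ is faithful. 4. $\mathrm{Tr}$ is essentially surjective. -/

import Mathlib

open CategoryTheory

universe u

/-! ### Hyperfields -/

/-- A canonical abelian hypergroup: a set with a multivalued commutative addition `hadd`. -/
class CanonicalHypergroup (H : Type u) extends Zero H, Neg H where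
  hadd : H → H → Set H
  hadd_assoc : ∀ x y z : H, (⋃ t ∈ hadd x y, hadd t z) = ⋃ t ∈ hadd y z, hadd x t
  hadd_comm : ∀ x y : H, hadd x y = hadd y x
  hadd_zero : ∀ x : H, hadd x 0 = {x}
  zero_mem_hadd_neg : ∀ x : H, 0 ∈ hadd x (-x)
  eq_neg_of_zero_mem : ∀ x y : H, 0 ∈ hadd x y → y = -x
  mem_hadd_neg_iff : ∀ x y z : H, x ∈ hadd y (-z) ↔ y ∈ hadd x z

/-- A multiring: a canonical abelian hypergroup with a (single valued) commutative associative
unital multiplication such that `(x + y) z ⊆ x z + y z`. -/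
class Multiring (H : Type u) extends CanonicalHypergroup H, CommMonoid H where
  hadd_mul_subset : ∀ x y z : H, (fun t => t * z) '' hadd x y ⊆ hadd (x * z) (y * z)

/-- A hyperfield: a multiring with `0 ≠ 1` in which every nonzero element is invertible. -/
class Hyperfield (H : Type u) extends Multiring H where
  exists_mul_eq_one : ∀ x : H, x ≠ 0 → ∃ y : H, x * y = 1
  zero_ne_one : (0 : H) ≠ 1

open CanonicalHypergroup

/-- A hyperfield is a field when its addition is single valued. -/
def Hyperfield.IsSingleValued (H : Type u) [Hyperfield H] : Prop :=
  ∀ x y : H, ∃ z : H, hadd x y = {z}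

section Metric

variable {H : Type u} [Hyperfield H]

open Classical in
/-- The distance `d(x, y) = |x - y|` for `x ≠ y`, and `d(x, x) = 0`.  In a valued hyperfield the
set of absolute values of the elements of `x - y` is a singleton for `x ≠ y`, and the supremum
picks its element. -/
noncomputable def hyperDist (ν : H → ℝ) (x y : H) : ℝ :=
  if x = y then 0 else sSup (ν '' hadd x (-y))

/-- The closed ball of radius `r` around `c`. -/
def hyperClosedBall (ν : H → ℝ) (c : H) (r : ℝ) : Set H := {z | hyperDist ν c z ≤ r}

/-- The open ball of radius `r` around `c`. -/
def hyperOpenBall (ν : H → ℝ) (c : H) (r : ℝ) : Set H := {z | hyperDist ν c z < r}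

/-- Either all sums `x + y` are closed balls of radius `ρ max(|x|, |y|)`, or all of them are open
balls of this radius.  In the open case the sum `0 + 0 = {0}` has to be left out, because the open
ball of radius `0` is empty. -/
def SumsAreBalls (ν : H → ℝ) (ρ : ℝ) : Prop :=
  (∀ x y : H, ∃ c : H, hadd x y = hyperClosedBall ν c (ρ * max (ν x) (ν y))) ∨
  (∀ x y : H, (x ≠ 0 ∨ y ≠ 0) →
    ∃ c : H, hadd x y = hyperOpenBall ν c (ρ * max (ν x) (ν y)))

end Metric

/-- A valued hyperfield in the sense of Krasner. -/
class ValuedHyperfield (H : Type u) extends Hyperfield H where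
  val : H → ℝ
  val_nonneg : ∀ x : H, 0 ≤ val x
  val_eq_zero_iff : ∀ x : H, val x = 0 ↔ x = 0
  val_mul : ∀ x y : H, val (x * y) = val x * val y
  val_le_max : ∀ x y z : H, z ∈ hadd x y → val z ≤ max (val x) (val y)
  val_eq_of_zero_notMem : ∀ x y : H, 0 ∉ hadd x y →
    ∀ z ∈ hadd x y, ∀ w ∈ hadd x y, val z = val w
  sumsAreBalls : ∃ ρ : ℝ, 0 < ρ ∧ SumsAreBalls val ρ

open ValuedHyperfield

namespace ValuedHyperfield

variable (H : Type u) [ValuedHyperfield H]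

/-- Discretely valued: `0` is the only non-isolated point of the image of the absolute value. -/
def IsDiscretelyValued : Prop :=
  ∀ a ∈ Set.range (val : H → ℝ),
    AccPt a (Filter.principal (Set.range (val : H → ℝ))) ↔ a = 0

/-- The norm `ρ_H`, the smallest `ρ > 0` for which the sums are balls. -/
noncomputable def krasnerNorm : ℝ := sInf {ρ : ℝ | 0 < ρ ∧ SumsAreBalls (val : H → ℝ) ρ}

/-- `θ_H`, the largest absolute value of a nonzero element which is less than `1`. -/
noncomputable def theta : ℝ := sSup {a : ℝ | a < 1 ∧ ∃ x : H, x ≠ 0 ∧ val x = a}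

/-- `𝒪_H`, the closed ball of radius `1` around `0`. -/
def integers : Set H := hyperClosedBall val 0 1

/-- `𝔪_H`, the closed ball of radius `θ_H` around `0`. -/
def maxIdeal : Set H := hyperClosedBall val 0 (theta H)

variable {H}

/-- The relation `x ≡_η y`, meaning `d(x, y) ≤ η`. -/
def congrMod (η : ℝ) (x y : H) : Prop := hyperDist val x y ≤ η

/-- A uniformizer is an element of absolute value `θ_H`. -/
def IsUniformizer (x : H) : Prop := val x = theta H

end ValuedHyperfield

/-- A homomorphism of valued hyperfields. -/
structure ValuedHyperfieldHom (H₁ H₂ : Type u) [ValuedHyperfield H₁] [ValuedHyperfield H₂] where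
  toFun : H₁ → H₂
  map_mul : ∀ x y : H₁, toFun (x * y) = toFun x * toFun y
  preimage_hadd : ∀ a ∈ Set.range toFun, ∀ b ∈ Set.range toFun,
    toFun ⁻¹' hadd a b = ⋃ x ∈ toFun ⁻¹' {a}, ⋃ y ∈ toFun ⁻¹' {b}, hadd x y
  val_map : ∀ x : H₁, val (toFun x) = val x
  fiber_one : ∃ (c : H₁) (r : ℝ),
    toFun ⁻¹' {1} = hyperClosedBall val c r ∨ toFun ⁻¹' {1} = hyperOpenBall val c r

/-! Facts needed to see that homomorphisms of valued hyperfields compose. -/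

section HypFacts

variable {H : Type u} [ValuedHyperfield H]

lemma hyp_val_one : val (1 : H) = 1 := by
  have h := val_mul (1 : H) 1
  have h0 : val (1 : H) ≠ 0 := fun h => Hyperfield.zero_ne_one ((val_eq_zero_iff (1 : H)).1 h).symm
  rw [mul_one] at h
  exact mul_left_cancel₀ h0 (by rw [← h, mul_one])

lemma hyp_val_zero : val (0 : H) = 0 := (val_eq_zero_iff _).2 rfl

lemma hyp_zero_mul (x : H) : 0 * x = 0 :=
  (val_eq_zero_iff _).1 (by rw [val_mul, hyp_val_zero, zero_mul])

lemma hyp_neg_one_mul (x : H) : -1 * x = -x := by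
  apply eq_neg_of_zero_mem
  have h := Multiring.hadd_mul_subset 1 (-1) x (Set.mem_image_of_mem _ (zero_mem_hadd_neg (1 : H)))
  simpa [hyp_zero_mul] using h

lemma hyp_neg_neg (x : H) : - -x = x := by
  have h := zero_mem_hadd_neg x
  rw [hadd_comm] at h
  exact (eq_neg_of_zero_mem _ _ h).symm

lemma hyp_val_neg (x : H) : val (-x) = val x := by
  have h1 : val (-1 : H) = 1 := by
    have h := val_mul (-1 : H) (-1)
    rw [hyp_neg_one_mul, hyp_neg_neg, hyp_val_one] at h
    have := val_nonneg (-1 : H)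
    nlinarith
  rw [← hyp_neg_one_mul, val_mul, h1, one_mul]

lemma hyp_hadd_nonempty (x y : H) : (hadd x y).Nonempty := by
  by_contra hne
  rw [Set.not_nonempty_iff_eq_empty] at hne
  have h := hadd_assoc x y (-y)
  have hx : x ∈ ⋃ t ∈ hadd y (-y), hadd x t := by
    simp only [Set.mem_iUnion]
    exact ⟨0, zero_mem_hadd_neg y, by rw [hadd_zero]; rfl⟩
  rw [← h, hne] at hx
  simp at hx

lemma hyp_zero_mem_sub {x y : H} (h : 0 ∈ hadd x (-y)) : x = y := by
  have := eq_neg_of_zero_mem _ _ h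
  rw [← hyp_neg_neg y, this, hyp_neg_neg]

lemma hyperDist_self (x : H) : hyperDist val x x = 0 := by simp [hyperDist]

lemma hyperDist_eq {x y z : H} (hxy : x ≠ y) (hz : z ∈ hadd x (-y)) :
    hyperDist val x y = val z := by
  have h : (val : H → ℝ) '' hadd x (-y) = {val z} := by
    refine Set.eq_singleton_iff_unique_mem.2 ?_
    refine ⟨⟨z, hz, rfl⟩, ?_⟩
    rintro _ ⟨w, hw, rfl⟩
    exact val_eq_of_zero_notMem _ _ (fun h0 => hxy (hyp_zero_mem_sub h0)) _ hw _ hz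
  rw [hyperDist, if_neg hxy, h, csSup_singleton]

lemma hyperDist_le {x y z : H} (hz : z ∈ hadd x (-y)) : hyperDist val x y ≤ val z := by
  by_cases hxy : x = y
  · subst hxy; rw [hyperDist_self]; exact val_nonneg z
  · exact (hyperDist_eq hxy hz).le

lemma hyperDist_nonneg (x y : H) : 0 ≤ hyperDist val x y := by
  by_cases hxy : x = y
  · subst hxy; rw [hyperDist_self]
  · obtain ⟨z, hz⟩ := hyp_hadd_nonempty x (-y)
    rw [hyperDist_eq hxy hz]; exact val_nonneg z

lemma hyperDist_comm (x y : H) : hyperDist val x y = hyperDist val y x := by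
  by_cases hxy : x = y
  · subst hxy; rfl
  · obtain ⟨z, hz⟩ := hyp_hadd_nonempty x (-y)
    have hz' : -z ∈ hadd y (-x) := by
      have h := Multiring.hadd_mul_subset x (-y) (-1) ⟨z, hz, rfl⟩
      simp only [mul_comm _ (-1 : H), hyp_neg_one_mul, hyp_neg_neg] at h
      rwa [hadd_comm]
    rw [hyperDist_eq hxy hz, hyperDist_eq (Ne.symm hxy) hz', hyp_val_neg]

lemma hyperDist_ultra (x y z : H) :
    hyperDist val x z ≤ max (hyperDist val x y) (hyperDist val y z) := by
  by_cases hxy : x = y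
  · subst hxy; exact le_max_right _ _
  by_cases hyz : y = z
  · subst hyz; exact le_max_left _ _
  obtain ⟨a, ha⟩ := hyp_hadd_nonempty x (-y)
  have hx : x ∈ hadd a y := (mem_hadd_neg_iff _ _ _).1 ha
  obtain ⟨c, hc⟩ := hyp_hadd_nonempty x (-z)
  have hc' : c ∈ ⋃ t ∈ hadd a y, hadd t (-z) := by
    simp only [Set.mem_iUnion]; exact ⟨x, hx, hc⟩
  rw [hadd_assoc] at hc'
  simp only [Set.mem_iUnion] at hc'
  obtain ⟨b, hb, hcb⟩ := hc'
  calc hyperDist val x z ≤ val c := hyperDist_le hc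
    _ ≤ max (val a) (val b) := val_le_max _ _ _ hcb
    _ = _ := by rw [hyperDist_eq hxy ha, hyperDist_eq hyz hb]

/-- Two elements of a sum `x + y` coincide if one of them has absolute value at least
`max(|x|, |y|)`. -/
lemma hyp_eq_of_mem_hadd {x y u w : H} (hu : u ∈ hadd x y) (hw : w ∈ hadd x y)
    (hx : val x ≤ val w) (hy : val y ≤ val w) : u = w := by
  obtain ⟨ρ, hρ, hB⟩ := sumsAreBalls (H := H)
  have hmax : ρ * max (val x) (val y) ≤ ρ * max (val w) (val (0 : H)) := by
    have : max (val x) (val y) ≤ max (val w) (val (0 : H)) := le_max_of_le_left (max_le hx hy)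
    gcongr
  have hwm : w ∈ hadd w 0 := by rw [hadd_zero]; rfl
  suffices h : u ∈ hadd w 0 by rwa [hadd_zero] at h
  rcases hB with hB | hB
  · obtain ⟨c, hc⟩ := hB x y
    obtain ⟨c', hc'⟩ := hB w 0
    rw [hc] at hu hw
    rw [hc'] at hwm ⊢
    simp only [hyperClosedBall, Set.mem_ofPred_eq] at *
    have h1 := hyperDist_ultra c' w u
    have h2 := hyperDist_ultra w c u
    rw [hyperDist_comm w c] at h2
    exact h1.trans (max_le hwm (h2.trans (max_le (hw.trans hmax) (hu.trans hmax))))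
  · by_cases h0 : w = 0
    · have hx0 : x = 0 := (val_eq_zero_iff x).1
        (le_antisymm (by rwa [h0, hyp_val_zero] at hx) (val_nonneg x))
      have hy0 : y = 0 := (val_eq_zero_iff y).1
        (le_antisymm (by rwa [h0, hyp_val_zero] at hy) (val_nonneg y))
      rw [h0]
      rwa [hx0, hy0] at hu
    have hxy : x ≠ 0 ∨ y ≠ 0 := by
      by_contra hcon
      push Not at hcon
      rw [hcon.1, hcon.2, hadd_zero] at hw
      exact h0 hw
    obtain ⟨c, hc⟩ := hB x y hxy
    obtain ⟨c', hc'⟩ := hB w 0 (Or.inl h0)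
    rw [hc] at hu hw
    rw [hc'] at hwm ⊢
    simp only [hyperOpenBall, Set.mem_ofPred_eq] at *
    have h1 := hyperDist_ultra c' w u
    have h2 := hyperDist_ultra w c u
    rw [hyperDist_comm w c] at h2
    exact h1.trans_lt (max_lt hwm
      (h2.trans_lt (max_lt (hw.trans_le hmax) (hu.trans_le hmax))))

lemma mem_hyperClosedBall_of_mem {c p z : H} {r : ℝ} (hp : p ∈ hyperClosedBall val c r) :
    z ∈ hyperClosedBall val c r ↔ z ∈ hyperClosedBall val p r := by
  simp only [hyperClosedBall, Set.mem_ofPred_eq] at *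
  constructor
  · intro h
    exact (hyperDist_ultra p c z).trans (max_le (by rwa [hyperDist_comm]) h)
  · intro h
    exact (hyperDist_ultra c p z).trans (max_le hp h)

lemma mem_hyperOpenBall_of_mem {c p z : H} {r : ℝ} (hp : p ∈ hyperOpenBall val c r) :
    z ∈ hyperOpenBall val c r ↔ z ∈ hyperOpenBall val p r := by
  simp only [hyperOpenBall, Set.mem_ofPred_eq] at *
  constructor
  · intro h
    exact (hyperDist_ultra p c z).trans_lt (max_lt (by rwa [hyperDist_comm]) h)
  · intro h
    exact (hyperDist_ultra c p z).trans_lt (max_lt hp h)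

end HypFacts

namespace ValuedHyperfieldHom

variable {H₁ H₂ H₃ : Type u} [ValuedHyperfield H₁] [ValuedHyperfield H₂] [ValuedHyperfield H₃]

@[ext] lemma ext {f g : ValuedHyperfieldHom H₁ H₂} (h : ∀ x, f.toFun x = g.toFun x) : f = g := by
  cases f; cases g
  congr
  exact funext h

lemma map_mem_hadd (f : ValuedHyperfieldHom H₁ H₂) {x y z : H₁} (h : z ∈ hadd x y) :
    f.toFun z ∈ hadd (f.toFun x) (f.toFun y) := by
  have := f.preimage_hadd _ ⟨x, rfl⟩ _ ⟨y, rfl⟩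
  have hz : z ∈ f.toFun ⁻¹' hadd (f.toFun x) (f.toFun y) := by
    rw [this]
    simp only [Set.mem_iUnion]
    exact ⟨x, rfl, y, rfl, h⟩
  exact hz

lemma map_zero' (f : ValuedHyperfieldHom H₁ H₂) : f.toFun 0 = 0 :=
  (val_eq_zero_iff _).1 (by rw [f.val_map, hyp_val_zero])

lemma map_one' (f : ValuedHyperfieldHom H₁ H₂) : f.toFun 1 = 1 := by
  have h0 : f.toFun 1 ≠ 0 := fun h => by
    have := f.val_map 1
    rw [h, hyp_val_zero, hyp_val_one] at this
    exact zero_ne_one this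
  obtain ⟨y, hy⟩ := Hyperfield.exists_mul_eq_one _ h0
  have h := f.map_mul 1 1
  rw [mul_one] at h
  calc f.toFun 1 = f.toFun 1 * (f.toFun 1 * y) := by rw [hy, mul_one]
    _ = 1 := by rw [← mul_assoc, ← h, hy]

lemma map_neg' (f : ValuedHyperfieldHom H₁ H₂) (x : H₁) : f.toFun (-x) = -f.toFun x := by
  apply eq_neg_of_zero_mem
  rw [← f.map_zero']
  exact f.map_mem_hadd (zero_mem_hadd_neg x)

lemma hyperDist_map (f : ValuedHyperfieldHom H₁ H₂) {x y : H₁} (h : f.toFun x ≠ f.toFun y) :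
    hyperDist val (f.toFun x) (f.toFun y) = hyperDist val x y := by
  have hxy : x ≠ y := fun hxy => h (by rw [hxy])
  obtain ⟨z, hz⟩ := hyp_hadd_nonempty x (-y)
  have hz' := f.map_mem_hadd hz
  rw [f.map_neg'] at hz'
  rw [hyperDist_eq h hz', hyperDist_eq hxy hz, f.val_map]

/-- The second homomorphism axiom follows from its weak form. -/
lemma preimage_hadd_of_map_mem (f : H₁ → H₂) (hval : ∀ x, val (f x) = val x)
    (hadd_mem : ∀ x y z, z ∈ hadd x y → f z ∈ hadd (f x) (f y)) (hneg : ∀ x, f (-x) = - f x) :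
    ∀ a ∈ Set.range f, ∀ b ∈ Set.range f,
      f ⁻¹' hadd a b = ⋃ x ∈ f ⁻¹' {a}, ⋃ y ∈ f ⁻¹' {b}, hadd x y := by
  have key : ∀ x y z : H₁, val y ≤ val x → f z ∈ hadd (f x) (f y) →
      ∃ x', f x' = f x ∧ z ∈ hadd x' y := by
    intro x y z hyx hz
    obtain ⟨x', hx'⟩ := hyp_hadd_nonempty z (-y)
    refine ⟨x', ?_, (mem_hadd_neg_iff _ _ _).1 hx'⟩
    have h1 : f x' ∈ hadd (f z) (-f y) := hneg y ▸ hadd_mem _ _ _ hx'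
    have h2 : f x ∈ hadd (f z) (-f y) := (mem_hadd_neg_iff _ _ _).2 hz
    have h3 : val (f z) ≤ val (f x) := by
      refine (val_le_max _ _ _ hz).trans (max_le le_rfl ?_)
      rwa [hval, hval]
    exact hyp_eq_of_mem_hadd h1 h2 h3 (by rwa [hyp_val_neg, hval, hval])
  rintro _ ⟨x, rfl⟩ _ ⟨y, rfl⟩
  ext z
  simp only [Set.mem_preimage, Set.mem_iUnion, Set.mem_singleton_iff, exists_prop]
  constructor
  · intro hz
    rcases le_total (val y) (val x) with h | h
    · obtain ⟨x', hx', hz'⟩ := key x y z h hz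
      exact ⟨x', hx', y, rfl, hz'⟩
    · rw [hadd_comm] at hz
      obtain ⟨y', hy', hz'⟩ := key y x z h hz
      exact ⟨x, rfl, y', hy', by rwa [hadd_comm]⟩
  · rintro ⟨x', hx', y', hy', hz⟩
    rw [← hx', ← hy']
    exact hadd_mem _ _ _ hz

/-- The identity homomorphism. -/
def id (H : Type u) [ValuedHyperfield H] : ValuedHyperfieldHom H H where
  toFun := fun x => x
  map_mul := fun _ _ => rfl
  preimage_hadd := preimage_hadd_of_map_mem _ (fun _ => rfl) (fun _ _ _ h => h) (fun _ => rfl)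
  val_map := fun _ => rfl
  fiber_one := by
    refine ⟨1, 0, Or.inl ?_⟩
    ext z
    simp only [Set.mem_preimage, Set.mem_singleton_iff, hyperClosedBall, Set.mem_ofPred_eq]
    constructor
    · rintro rfl; rw [hyperDist_self]
    · intro h
      by_contra hz
      obtain ⟨w, hw⟩ := hyp_hadd_nonempty 1 (-z)
      rw [hyperDist_eq (Ne.symm hz) hw] at h
      rw [(val_eq_zero_iff w).1 (le_antisymm h (val_nonneg w))] at hw
      exact hz (hyp_zero_mem_sub hw).symm

/-- Composition of homomorphisms: first `f`, then `g`. -/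
def comp (f : ValuedHyperfieldHom H₁ H₂) (g : ValuedHyperfieldHom H₂ H₃) :
    ValuedHyperfieldHom H₁ H₃ where
  toFun := fun x => g.toFun (f.toFun x)
  map_mul := fun x y => by rw [f.map_mul, g.map_mul]
  preimage_hadd := preimage_hadd_of_map_mem _ (fun x => by rw [g.val_map, f.val_map])
    (fun _ _ _ h => g.map_mem_hadd (f.map_mem_hadd h)) (fun x => by rw [f.map_neg', g.map_neg'])
  val_map := fun x => by rw [g.val_map, f.val_map]
  fiber_one := by
    have hdist : ∀ x, f.toFun x ≠ 1 → hyperDist val 1 (f.toFun x) = hyperDist val 1 x := by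
      intro x hx
      have := f.hyperDist_map (x := 1) (y := x) (by rw [f.map_one']; exact Ne.symm hx)
      rwa [f.map_one'] at this
    -- the fiber of `f` over `1`, with centre `1`
    have hf1 : (1 : H₁) ∈ f.toFun ⁻¹' {1} := f.map_one'
    have hg1 : (1 : H₂) ∈ g.toFun ⁻¹' {1} := g.map_one'
    -- balls around `1` are totally ordered, described as sets of distances
    have hF : ∃ S : Set ℝ, ((∃ r, S = Set.Iic r) ∨ (∃ r, S = Set.Iio r)) ∧
        ∀ x, f.toFun x = 1 ↔ hyperDist val 1 x ∈ S := by
      obtain ⟨c, r, h | h⟩ := f.fiber_one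
      · refine ⟨Set.Iic r, Or.inl ⟨r, rfl⟩, fun x => ?_⟩
        have hx : x ∈ f.toFun ⁻¹' {1} ↔ x ∈ hyperClosedBall val 1 r := by
          rw [h] at hf1 ⊢; exact mem_hyperClosedBall_of_mem hf1
        exact hx
      · refine ⟨Set.Iio r, Or.inr ⟨r, rfl⟩, fun x => ?_⟩
        have hx : x ∈ f.toFun ⁻¹' {1} ↔ x ∈ hyperOpenBall val 1 r := by
          rw [h] at hf1 ⊢; exact mem_hyperOpenBall_of_mem hf1
        exact hx
    have hG : ∃ S : Set ℝ, ((∃ r, S = Set.Iic r) ∨ (∃ r, S = Set.Iio r)) ∧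
        ∀ x, g.toFun x = 1 ↔ hyperDist val 1 x ∈ S := by
      obtain ⟨c, r, h | h⟩ := g.fiber_one
      · refine ⟨Set.Iic r, Or.inl ⟨r, rfl⟩, fun x => ?_⟩
        have hx : x ∈ g.toFun ⁻¹' {1} ↔ x ∈ hyperClosedBall val 1 r := by
          rw [h] at hg1 ⊢; exact mem_hyperClosedBall_of_mem hg1
        exact hx
      · refine ⟨Set.Iio r, Or.inr ⟨r, rfl⟩, fun x => ?_⟩
        have hx : x ∈ g.toFun ⁻¹' {1} ↔ x ∈ hyperOpenBall val 1 r := by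
          rw [h] at hg1 ⊢; exact mem_hyperOpenBall_of_mem hg1
        exact hx
    obtain ⟨S, hS, hSf⟩ := hF
    obtain ⟨T, hT, hTg⟩ := hG
    have hmem : ∀ x, g.toFun (f.toFun x) = 1 ↔ hyperDist val 1 x ∈ S ∪ T := by
      intro x
      by_cases hx : f.toFun x = 1
      · exact ⟨fun _ => Or.inl ((hSf x).1 hx), fun _ => by rw [hx, g.map_one']⟩
      · rw [hTg, hdist x hx]
        exact ⟨Or.inr, fun h => h.resolve_left fun h' => hx ((hSf x).2 h')⟩
    have hU : (∃ r, S ∪ T = Set.Iic r) ∨ (∃ r, S ∪ T = Set.Iio r) := by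
      have hlow : ∀ {U : Set ℝ}, ((∃ r, U = Set.Iic r) ∨ (∃ r, U = Set.Iio r)) →
          IsLowerSet U := by
        rintro U (⟨r, rfl⟩ | ⟨r, rfl⟩)
        · exact isLowerSet_Iic r
        · exact isLowerSet_Iio r
      rcases (hlow hS).total (hlow hT) with h | h
      · rw [Set.union_eq_self_of_subset_left h]; exact hT
      · rw [Set.union_eq_self_of_subset_right h]; exact hS
    rcases hU with ⟨r, hr⟩ | ⟨r, hr⟩
    · refine ⟨1, r, Or.inl ?_⟩
      ext x
      have := hmem x
      rw [hr] at this
      exact this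
    · refine ⟨1, r, Or.inr ?_⟩
      ext x
      have := hmem x
      rw [hr] at this
      exact this

end ValuedHyperfieldHom

/-- The discretely valued hyperfields which are not fields. -/
structure DVHyp : Type (u + 1) where
  carrier : Type u
  [valuedHyperfield : ValuedHyperfield carrier]
  discretelyValued : IsDiscretelyValued carrier
  not_field : ¬ Hyperfield.IsSingleValued carrier

attribute [instance] DVHyp.valuedHyperfield

/-- The category of discretely valued hyperfields which are not fields. -/
instance DVHyp.category : Category.{u} DVHyp.{u} where
  Hom H₁ H₂ := ValuedHyperfieldHom H₁.carrier H₂.carrier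
  id H := ValuedHyperfieldHom.id H.carrier
  comp f g := ValuedHyperfieldHom.comp f g

/-! ### Triples -/

/-- A truncated DVR: a local Artinian ring whose maximal ideal is principal. -/
class IsTruncatedDVR (R : Type u) [CommRing R] : Prop extends IsLocalRing R, IsArtinianRing R where
  isPrincipal_maximalIdeal : (IsLocalRing.maximalIdeal R).IsPrincipal

/-- A triple `(R, M, ε)` in the sense of Deligne. -/
structure Triple : Type (u + 1) where
  R : Type u
  M : Type u
  [commRing : CommRing R]
  [isTruncatedDVR : IsTruncatedDVR R]
  [addCommGroup : AddCommGroup M]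
  [module : Module R M]
  [free : Module.Free R M]
  finrank_eq_one : Module.finrank R M = 1
  ε : M →ₗ[R] R
  range_ε : LinearMap.range ε = IsLocalRing.maximalIdeal R

attribute [instance] Triple.commRing Triple.isTruncatedDVR Triple.addCommGroup Triple.module
  Triple.free

/-- The tensor power `M^{⊗ n}`, as the degree `n` part of the tensor algebra of `M`. -/
abbrev tensorPow (R : Type u) [CommRing R] (M : Type u) [AddCommGroup M] [Module R M] (n : ℕ) :
    Submodule R (TensorAlgebra R M) :=
  LinearMap.range (TensorAlgebra.ι R : M →ₗ[R] TensorAlgebra R M) ^ n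

section Tensor

variable {R S : Type u} [CommRing R] [CommRing S] (φ : R →+* S)
variable {M : Type u} [AddCommGroup M] [Module R M]

/-- For a `φ`-semilinear map `η : M → A` to an `S`-algebra, the multiplicative extension of `η` to
the tensor algebra of `M`, given by `m₁ ⊗ ⋯ ⊗ mₖ ↦ η m₁ ⋯ η mₖ`.  If `A` is the tensor algebra
of an `S`-module `N` and `η` has values in `N^{⊗ s}`, then its restriction to `M^{⊗ k}` is the map
`η^{⊗ k} : M^{⊗ k} → (N^{⊗ s})^{⊗ k} = N^{⊗ s k}`. -/
noncomputable def semiLift {A : Type u} [Ring A] [Algebra S A] (η : M →ₛₗ[φ] A) :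
    TensorAlgebra R M →+* A :=
  letI : Algebra R A := Algebra.compHom A φ
  (TensorAlgebra.lift R
    ({ toFun := η, map_add' := η.map_add, map_smul' := η.map_smulₛₗ } : M →ₗ[R] A)).toRingHom

/-- For a `φ`-semilinear map `η : M → N`, the assertion that the induced `S`-linear map
`S ⊗ M → N` is an isomorphism. -/
def InducesIso {N : Type u} [AddCommGroup N] [Module S N] (η : M →ₛₗ[φ] N) : Prop :=
  letI : Algebra R S := φ.toAlgebra
  letI : Module R N := Module.compHom N φ
  haveI : IsScalarTower R S N := IsScalarTower.of_algebraMap_smul fun _ _ => rfl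
  IsBaseChange S
    ({ toFun := η, map_add' := η.map_add, map_smul' := η.map_smulₛₗ } : M →ₗ[R] N)

end Tensor

namespace Triple

/-- The map `ε_{0,r} : M^{⊗ r} → R`, `x₁ ⊗ ⋯ ⊗ x_r ↦ ε(x₁) ⋯ ε(x_r)`. -/
noncomputable def εPow (T : Triple.{u}) (r : ℕ) : tensorPow T.R T.M r →ₗ[T.R] T.R :=
  (TensorAlgebra.lift T.R T.ε).toLinearMap ∘ₗ (tensorPow T.R T.M r).subtype

/-- A morphism of triples. -/
structure Hom (T T' : Triple.{u}) where
  /-- the ramification index -/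
  r : ℕ
  r_pos : 0 < r
  φ : T.R →+* T'.R
  η : T.M →ₛₗ[φ] tensorPow T'.R T'.M r
  comm : ∀ m : T.M, φ (T.ε m) = T'.εPow r (η m)
  inducesIso : InducesIso φ η

end Triple

section TensorFacts

variable {R S U : Type u} [CommRing R] [CommRing S] [CommRing U] {φ : R →+* S} {ψ : S →+* U}
variable {M N P : Type u} [AddCommGroup M] [Module R M] [AddCommGroup N] [Module S N]
  [AddCommGroup P] [Module U P]

lemma semiLift_ι {A : Type u} [Ring A] [Algebra S A] (η : M →ₛₗ[φ] A) (m : M) :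
    semiLift φ η (TensorAlgebra.ι R m) = η m := by
  let : Algebra R A := Algebra.compHom A φ
  exact TensorAlgebra.lift_ι_apply _ _

lemma semiLift_algebraMap {A : Type u} [Ring A] [Algebra S A] (η : M →ₛₗ[φ] A) (a : R) :
    semiLift φ η (algebraMap R _ a) = algebraMap S A (φ a) := by
  let : Algebra R A := Algebra.compHom A φ
  exact AlgHom.commutes _ _

lemma semiLift_smul {A : Type u} [Ring A] [Algebra S A] (η : M →ₛₗ[φ] A) (a : R)
    (x : TensorAlgebra R M) : semiLift φ η (a • x) = φ a • semiLift φ η x := by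
  rw [Algebra.smul_def, map_mul, semiLift_algebraMap, ← Algebra.smul_def]

lemma tensorAlgebra_ringHom_ext {A : Type u} [Ring A] {f g : TensorAlgebra R M →+* A}
    (h₁ : ∀ a, f (algebraMap R _ a) = g (algebraMap R _ a))
    (h₂ : ∀ m, f (TensorAlgebra.ι R m) = g (TensorAlgebra.ι R m)) : f = g := by
  ext x
  induction x using TensorAlgebra.induction with
  | algebraMap a => exact h₁ a
  | ι m => exact h₂ m
  | mul a b ha hb => rw [map_mul, map_mul, ha, hb]
  | add a b ha hb => rw [map_add, map_add, ha, hb]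

lemma semiLift_mem {s : ℕ} (η : M →ₛₗ[φ] TensorAlgebra S N) (hη : ∀ m, η m ∈ tensorPow S N s)
    (k : ℕ) (x : TensorAlgebra R M) (hx : x ∈ tensorPow R M k) :
    semiLift φ η x ∈ tensorPow S N (s * k) := by
  induction hx using Submodule.pow_induction_on_left' with
  | algebraMap a =>
    rw [semiLift_algebraMap, mul_zero, tensorPow, pow_zero]
    exact Submodule.algebraMap_mem _
  | add x y i _ _ hx hy => rw [map_add]; exact Submodule.add_mem _ hx hy
  | mem_mul m hm i x _ hx =>
    obtain ⟨m, rfl⟩ := hm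
    rw [map_mul, semiLift_ι, Nat.succ_eq_add_one, mul_add_one, add_comm, tensorPow, pow_add]
    exact Submodule.mul_mem_mul (hη m) hx

/-- If `x` generates the free module `M`, then `x^{⊗ n}` generates the free module `M^{⊗ n}`. -/
lemma tensorPow_generator {x : M} (hx : Function.Bijective fun a : R => a • x) (n : ℕ)
    (y : tensorPow R M n)
    (hy : (y : TensorAlgebra R M) = TensorAlgebra.ι R x ^ n) :
    Function.Bijective fun a : R => a • y := by
  constructor
  · let e : R ≃ₗ[R] M := LinearEquiv.ofBijective (LinearMap.toSpanSingleton R M x) hx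
    have he : e.symm x = 1 := by
      rw [LinearEquiv.symm_apply_eq]; exact (one_smul R x).symm
    let F : TensorAlgebra R M →ₐ[R] Polynomial R := TensorAlgebra.lift R
      ((LinearMap.toSpanSingleton R (Polynomial R) Polynomial.X) ∘ₗ e.symm.toLinearMap)
    have hF : F (TensorAlgebra.ι R x) = Polynomial.X := by
      simp [F, he]
    intro a b hab
    have h : a • (TensorAlgebra.ι R x ^ n) = b • (TensorAlgebra.ι R x ^ n) := by
      have := congrArg (fun z : tensorPow R M n => (z : TensorAlgebra R M)) hab
      simpa [hy] using this
    have h' := congrArg (fun z => (F z).coeff n) h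
    simpa [map_smul, map_pow, hF] using h'
  · have hspan : LinearMap.range (TensorAlgebra.ι R : M →ₗ[R] TensorAlgebra R M) =
        Submodule.span R {TensorAlgebra.ι R x} := by
      apply le_antisymm
      · rintro _ ⟨m, rfl⟩
        obtain ⟨a, rfl⟩ := hx.2 m
        simp only [map_smul]
        exact Submodule.smul_mem _ _ (Submodule.mem_span_singleton_self _)
      · rw [Submodule.span_le]
        rintro _ rfl
        exact ⟨x, rfl⟩
    rintro ⟨z, hz⟩
    have hz' := hz
    rw [tensorPow, hspan, Submodule.span_pow, Set.singleton_pow, Submodule.mem_span_singleton] at hz'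
    obtain ⟨a, ha⟩ := hz'
    exact ⟨a, Subtype.ext (by simp [hy, ha])⟩

/-- A semilinear map from a free module of rank one with generator `x` induces an isomorphism
if and only if the image of `x` is a generator of a free module. -/
lemma inducesIso_iff {x : M} (hx : Function.Bijective fun a : R => a • x) (η : M →ₛₗ[φ] N) :
    InducesIso φ η ↔ Function.Bijective fun b : S => b • η x := by
  let : Algebra R S := φ.toAlgebra
  let : Module R N := Module.compHom N φ
  have : IsScalarTower R S N := IsScalarTower.of_algebraMap_smul fun _ _ => rfl
  let e : R ≃ₗ[R] M := LinearEquiv.ofBijective (LinearMap.toSpanSingleton R M x) hx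
  let E : S ≃ TensorProduct R S M :=
    ((TensorProduct.rid R S).symm.trans (TensorProduct.congr (LinearEquiv.refl R S) e)).toEquiv
  let η' : M →ₗ[R] N := { toFun := η, map_add' := η.map_add, map_smul' := η.map_smulₛₗ }
  let L := TensorProduct.lift
    (((Algebra.linearMap S <| Module.End S (M →ₗ[R] N)).flip η').restrictScalars R)
  have hE : (fun b : S => b • η x) = L ∘ E := by
    funext b
    have he : e 1 = x := one_smul R x
    have hb : E b = b ⊗ₜ[R] x := by simp [E, he]
    rw [Function.comp_apply, hb]
    simp only [L, TensorProduct.lift.tmul]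
    rfl
  rw [hE]
  exact (Function.Bijective.of_comp_iff L E.bijective).symm

lemma exists_isUnit_smul_eq {x y : N} (hx : Function.Bijective fun a : S => a • x)
    (hy : Function.Bijective fun a : S => a • y) : ∃ c : S, IsUnit c ∧ y = c • x := by
  obtain ⟨c, hc⟩ := hx.2 y
  obtain ⟨d, hd⟩ := hy.2 x
  refine ⟨c, IsUnit.of_mul_eq_one d (hx.1 ?_), hc.symm⟩
  simp only at hc hd ⊢
  rw [mul_comm, mul_smul, hc, hd, one_smul]

lemma bijective_of_isUnit_smul_eq {x y : N} {c : S}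
    (hx : Function.Bijective fun a : S => a • x) (hc : IsUnit c) (hy : y = c • x) :
    Function.Bijective fun a : S => a • y := by
  subst hy
  simp only [smul_smul]
  exact hx.comp (Units.mulRight_bijective hc.unit)

end TensorFacts

namespace Triple

lemma exists_generator (T : Triple.{u}) :
    ∃ x : T.M, Function.Bijective fun a : T.R => a • x := by
  let b := Module.basisUnique (Fin 1) T.finrank_eq_one
  refine ⟨b 0, fun a a' h => ?_, fun m => ⟨b.repr m 0, ?_⟩⟩
  · have := congrArg (fun z => b.repr z 0) h
    simpa using this
  · have := b.sum_repr m
    simpa using this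

variable {T T' T'' : Triple.{u}}

/-- Two morphisms of triples agree if their three components do. -/
lemma Hom.ext' {f g : Hom T T'} (hr : f.r = g.r) (hφ : f.φ = g.φ)
    (hη : ∀ m, (f.η m : TensorAlgebra T'.R T'.M) = g.η m) : f = g := by
  obtain ⟨r, _, φ, η, _, _⟩ := f
  obtain ⟨r', _, φ', η', _, _⟩ := g
  obtain rfl : r = r' := hr
  obtain rfl : φ = φ' := hφ
  obtain rfl : η = η' := LinearMap.ext fun m => Subtype.ext (hη m)
  rfl

/-- `η` with values in the tensor algebra. -/
noncomputable def Hom.ηT (f : Hom T T') : T.M →ₛₗ[f.φ] TensorAlgebra T'.R T'.M :=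
  (tensorPow T'.R T'.M f.r).subtype.comp f.η

/-- `η^{⊗ k}` for all `k` together, as a map between tensor algebras. -/
noncomputable def Hom.tensorMap (f : Hom T T') :
    TensorAlgebra T.R T.M →+* TensorAlgebra T'.R T'.M :=
  semiLift f.φ f.ηT

lemma Hom.tensorMap_ι (f : Hom T T') (m : T.M) :
    f.tensorMap (TensorAlgebra.ι T.R m) = f.η m := semiLift_ι _ _

lemma Hom.tensorMap_mem (f : Hom T T') (k : ℕ) (x : tensorPow T.R T.M k) :
    f.tensorMap x ∈ tensorPow T'.R T'.M (f.r * k) :=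
  semiLift_mem f.ηT (fun m => (f.η m).2) k x x.2

/-- The map `η^{⊗ k} : M^{⊗ k} → M'^{⊗ r k}`. -/
noncomputable def Hom.ηPow (f : Hom T T') (k : ℕ) :
    tensorPow T.R T.M k →ₛₗ[f.φ] tensorPow T'.R T'.M (f.r * k) where
  toFun x := ⟨f.tensorMap x, f.tensorMap_mem k x⟩
  map_add' x y := Subtype.ext (map_add f.tensorMap (x : TensorAlgebra T.R T.M) y)
  map_smul' a x := Subtype.ext (semiLift_smul _ a (x : TensorAlgebra T.R T.M))

lemma Hom.εPow_ηPow (f : Hom T T') (k : ℕ) (x : tensorPow T.R T.M k) :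
    T'.εPow (f.r * k) (f.ηPow k x) = f.φ (T.εPow k x) := by
  have h : ((TensorAlgebra.lift T'.R T'.ε).toRingHom.comp f.tensorMap) =
      f.φ.comp (TensorAlgebra.lift T.R T.ε).toRingHom := by
    apply tensorAlgebra_ringHom_ext
    · intro a
      simp [Hom.tensorMap, semiLift_algebraMap]
    · intro m
      have := f.comm m
      simp only [εPow, LinearMap.comp_apply, Submodule.subtype_apply,
        AlgHom.toLinearMap_apply] at this
      simp [Hom.tensorMap_ι, this]
  exact congrArg (fun F : TensorAlgebra T.R T.M →+* T'.R => F x) h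

/-- The identity `(1, id, M = M^{⊗ 1})`. -/
noncomputable def Hom.id (T : Triple.{u}) : Hom T T where
  r := 1
  r_pos := one_pos
  φ := RingHom.id T.R
  η := (TensorAlgebra.ι T.R : T.M →ₗ[T.R] TensorAlgebra T.R T.M).codRestrict
    (tensorPow T.R T.M 1) (fun m => by rw [tensorPow, pow_one]; exact ⟨m, rfl⟩)
  comm m := by simp [εPow]
  inducesIso := by
    obtain ⟨x, hx⟩ := T.exists_generator
    rw [inducesIso_iff hx]
    exact tensorPow_generator hx 1 _ (by simp)

/-- The composition `(s, ψ, θ) ∘ (r, φ, η) = (s r, ψ φ, θ^{⊗ r} η)` of `f = (r, φ, η)`, applied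
first, and `g = (s, ψ, θ)`. -/
noncomputable def Hom.comp (f : Hom T T') (g : Hom T' T'') : Hom T T'' where
  r := g.r * f.r
  r_pos := Nat.mul_pos g.r_pos f.r_pos
  φ := g.φ.comp f.φ
  η := haveI : RingHomCompTriple f.φ g.φ (g.φ.comp f.φ) := ⟨rfl⟩
    (g.ηPow f.r).comp f.η
  comm m := by
    have h := g.εPow_ηPow f.r (f.η m)
    rw [← f.comm] at h
    exact h.symm
  inducesIso := by
    obtain ⟨x, hx⟩ := T.exists_generator
    obtain ⟨x', hx'⟩ := T'.exists_generator
    obtain ⟨x'', hx''⟩ := T''.exists_generator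
    rw [inducesIso_iff hx]
    have hf := (inducesIso_iff hx _).1 f.inducesIso
    have hg := (inducesIso_iff hx' _).1 g.inducesIso
    have hy' : TensorAlgebra.ι T'.R x' ^ f.r ∈ tensorPow T'.R T'.M f.r :=
      Submodule.pow_mem_pow _ (LinearMap.mem_range_self _ x') _
    have hy'' : TensorAlgebra.ι T''.R x'' ^ g.r ∈ tensorPow T''.R T''.M g.r :=
      Submodule.pow_mem_pow _ (LinearMap.mem_range_self _ x'') _
    have hz'' : TensorAlgebra.ι T''.R x'' ^ (g.r * f.r) ∈ tensorPow T''.R T''.M (g.r * f.r) :=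
      Submodule.pow_mem_pow _ (LinearMap.mem_range_self _ x'') _
    obtain ⟨u, hu, hfu⟩ := exists_isUnit_smul_eq
      (tensorPow_generator hx' f.r ⟨_, hy'⟩ rfl) hf
    obtain ⟨w, hw, hgw⟩ := exists_isUnit_smul_eq
      (tensorPow_generator hx'' g.r ⟨_, hy''⟩ rfl) hg
    refine bijective_of_isUnit_smul_eq (c := g.φ u * w ^ f.r)
      (tensorPow_generator hx'' (g.r * f.r) ⟨_, hz''⟩ rfl)
      ((hu.map g.φ).mul (hw.pow _)) (Subtype.ext ?_)
    have e1 : (f.η x : TensorAlgebra T'.R T'.M) = u • TensorAlgebra.ι T'.R x' ^ f.r := by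
      rw [hfu]; rfl
    have e2 : (g.η x' : TensorAlgebra T''.R T''.M) = w • TensorAlgebra.ι T''.R x'' ^ g.r := by
      rw [hgw]; rfl
    change g.tensorMap (f.η x) =
      (g.φ u * w ^ f.r) • TensorAlgebra.ι T''.R x'' ^ (g.r * f.r)
    rw [e1, Hom.tensorMap, semiLift_smul, map_pow]
    change g.φ u • (g.tensorMap _) ^ f.r = _
    rw [Hom.tensorMap_ι, e2, smul_pow, ← pow_mul, smul_smul]

lemma Hom.comp_η_coe (f : Hom T T') (g : Hom T' T'') (m : T.M) :
    ((Hom.comp f g).η m : TensorAlgebra T''.R T''.M) = g.tensorMap (f.η m) := rfl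

lemma Hom.id_η_coe (m : T.M) :
    ((Hom.id T).η m : TensorAlgebra T.R T.M) = TensorAlgebra.ι T.R m := rfl

/-- Deligne's category of triples. -/
noncomputable instance category : Category.{u} Triple.{u} where
  Hom := Triple.Hom
  id := Triple.Hom.id
  comp := Triple.Hom.comp
  id_comp f := by
    apply Hom.ext'
    · exact mul_one _
    · rfl
    · intro m
      change f.tensorMap (TensorAlgebra.ι _ m) = _
      exact f.tensorMap_ι m
  comp_id {T T'} f := by
    apply Hom.ext'
    · exact one_mul _
    · rfl
    · intro m
      have h : (Hom.id T').tensorMap = RingHom.id (TensorAlgebra T'.R T'.M) := by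
        apply tensorAlgebra_ringHom_ext
        · intro a; exact semiLift_algebraMap _ _
        · intro m; exact semiLift_ι _ _
      exact congrArg (fun F : TensorAlgebra T'.R T'.M →+* TensorAlgebra T'.R T'.M => F (f.η m)) h
  assoc f g h := by
    apply Hom.ext'
    · exact (mul_assoc _ _ _).symm
    · rfl
    · intro m
      have H : (Hom.comp g h).tensorMap = h.tensorMap.comp g.tensorMap := by
        apply tensorAlgebra_ringHom_ext
        · intro a
          simp only [Hom.tensorMap, RingHom.comp_apply, semiLift_algebraMap]
          rfl
        · intro m
          rw [RingHom.comp_apply, Hom.tensorMap_ι, Hom.tensorMap_ι]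
          exact Hom.comp_η_coe g h m
      exact (congrArg (fun F : TensorAlgebra _ _ →+* TensorAlgebra _ _ =>
        F (f.η m : TensorAlgebra _ _)) H).symm

end Triple

/-! ### The triple of a discretely valued hyperfield -/

/-- The data exhibiting a triple `T` as `(𝒪_H / ≡_ρ, 𝔪_H / ≡_{θρ}, ε)`, where `ρ = ρ_H` and
`θ = θ_H`: the reduction maps `𝒪_H → R` and `𝔪_H → M` identify `R` and `M` with the quotient sets,
and addition, multiplication, scalar multiplication and `ε` are computed on representatives. -/
structure TripleReduction (H : Type u) [ValuedHyperfield H] (T : Triple.{u}) where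
  redR : integers H → T.R
  redR_surjective : Function.Surjective redR
  redR_eq_iff : ∀ x y : integers H,
    redR x = redR y ↔ congrMod (krasnerNorm H) (x : H) (y : H)
  redR_add : ∀ x y z : integers H, (z : H) ∈ hadd (x : H) (y : H) → redR z = redR x + redR y
  redR_mul : ∀ x y z : integers H, (z : H) = x * y → redR z = redR x * redR y
  redR_one : ∀ x : integers H, (x : H) = 1 → redR x = 1
  redM : maxIdeal H → T.M
  redM_surjective : Function.Surjective redM
  redM_eq_iff : ∀ x y : maxIdeal H,
    redM x = redM y ↔ congrMod (theta H * krasnerNorm H) (x : H) (y : H)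
  redM_add : ∀ x y z : maxIdeal H, (z : H) ∈ hadd (x : H) (y : H) → redM z = redM x + redM y
  redM_smul : ∀ (a : integers H) (x y : maxIdeal H), (y : H) = a * x → redM y = redR a • redM x
  ε_redM : ∀ (x : maxIdeal H) (y : integers H), (x : H) = y → T.ε (redM x) = redR y

/-- The triple morphism `(r, φ, η)` is the one induced by `f : H → H'`: the ramification index is
`log θ_H / log θ_{H'}`, the map `φ` sends the class of `x` to the class of `f(x)`, and `η` sends the
class of `x` to the class of `f(x)` in `M'_r = 𝔪_{H'}^r / ≡_{ρ' θ'^r}`, which is identified with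
`M'^{⊗ r}` through `[u π^r] ↦ [u] [π]^{⊗ r}` for uniformizers `π` of `H'`. -/
def IsInducedBy {H H' : Type u} [ValuedHyperfield H] [ValuedHyperfield H'] {T T' : Triple.{u}}
    (p : TripleReduction H T) (p' : TripleReduction H' T')
    (f : ValuedHyperfieldHom H H') (F : Triple.Hom T T') : Prop :=
  (F.r : ℝ) = Real.log (theta H) / Real.log (theta H') ∧
  (∀ (x : integers H) (y : integers H'), (y : H') = f.toFun x → F.φ (p.redR x) = p'.redR y) ∧
  (∀ (x : maxIdeal H) (ϖ : maxIdeal H') (a : integers H'), IsUniformizer (ϖ : H') →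
    f.toFun x = (a : H') * (ϖ : H') ^ F.r →
    (F.η (p.redM x) : TensorAlgebra T'.R T'.M) =
      p'.redR a • TensorAlgebra.ι T'.R (p'.redM ϖ) ^ F.r)

/-! ### Arithmetic and distance in valued hyperfields -/

namespace ValuedHyperfield

section Basic

variable {H : Type u} [ValuedHyperfield H]

/-! The ball axiom says that a sum of elements of size at most `s` is known only up to an error of
size `ρ s`. At scale `1` the error is `ρ_H`, so addition becomes single valued on `𝒪_H / ≡_{ρ_H}`.
Making this precise needs two facts. First, discreteness forces the nonzero absolute values to be
the integral powers of `θ_H`, so radii can be rounded: all sums are closed balls and `ρ_H = θ_H ^ k`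
with `k ≥ 1` (`exists_krasnerNorm_eq_pow`). Second, sums of congruent elements are congruent
(`hyperDist_le_of_mem_hadd`). The quotient is then a local ring whose maximal ideal is generated by
the class of a uniformizer, and the `k`-th power of this class vanishes. Multiplication by a
uniformizer scales distances by `θ_H`, so it identifies `R` with `M`.

A homomorphism does not increase distances, and it satisfies `ρ_H ≤ ρ_{H'}`, so it descends to `φ`.
It sends a uniformizer to a unit times `ϖ ^ r`, which gives `η`. The characterization `IsInducedBy`
makes sense for arbitrary reduction data and determines the morphism (`IsInducedBy.unique`).
Together with `IsInducedBy.comp` this yields functoriality, and it also shows that any two triples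
of the same hyperfield are isomorphic.

Faithfulness rests on `x + 0 = {x}` being a ball of radius `ρ_H |x|`: a unit is determined by its
class in `R` and a uniformizer by its class in `M`, and these elements generate the multiplicative
group (`IsInducedBy.eq_of_eq`).

The same observation shows which hyperfield to build from a triple: its nonzero elements must be
symbols `u π ^ n` with `u` a unit of `R` and `n` an integer. Every such element has a reduction in
`R` at each level `i ≤ n`, and `z` belongs to `x + y` when the reductions add up at all common
levels. The top common level decides (`mem_sum_of_max_level`), the threefold sum has a symmetric
description (`mem_iUnion_sum_iff`), and balls are fibres of reduction maps
(`hyperDist_absVal_le_iff`). -/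

lemma val_pos {x : H} (hx : x ≠ 0) : 0 < val x :=
  lt_of_le_of_ne (val_nonneg x) fun h => hx ((val_eq_zero_iff x).1 h.symm)

lemma ne_zero_of_val_pos {x : H} (hx : 0 < val x) : x ≠ 0 := by
  rintro rfl
  rw [hyp_val_zero] at hx
  exact lt_irrefl _ hx

lemma val_pow (x : H) (n : ℕ) : val (x ^ n) = val x ^ n := by
  induction n with
  | zero => rw [pow_zero, pow_zero, hyp_val_one]
  | succ n ih => rw [pow_succ, val_mul, ih, pow_succ]

lemma exists_val_eq_inv {x : H} (hx : x ≠ 0) : ∃ y : H, x * y = 1 ∧ val y = (val x)⁻¹ := by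
  obtain ⟨y, hy⟩ := Hyperfield.exists_mul_eq_one x hx
  refine ⟨y, hy, eq_inv_of_mul_eq_one_right ?_⟩
  rw [← val_mul, hy, hyp_val_one]

lemma exists_eq_mul (x : H) {y : H} (hy : y ≠ 0) : ∃ a : H, x = a * y ∧ val a = val x / val y := by
  obtain ⟨z, hz, hv⟩ := exists_val_eq_inv hy
  refine ⟨x * z, ?_, ?_⟩
  · rw [mul_assoc, mul_comm z, hz, mul_one]
  · rw [val_mul, hv, div_eq_mul_inv]

lemma mul_right_cancel_of_ne_zero {x y z : H} (hz : z ≠ 0) (h : x * z = y * z) : x = y := by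
  obtain ⟨w, hw⟩ := Hyperfield.exists_mul_eq_one z hz
  rw [← mul_one x, ← hw, ← mul_assoc, h, mul_assoc, hw, mul_one]

lemma mul_mem_hadd {x y t : H} (h : t ∈ hadd x y) (z : H) : t * z ∈ hadd (x * z) (y * z) :=
  Multiring.hadd_mul_subset x y z ⟨t, h, rfl⟩

lemma mul_mem_hadd_iff {x y t z : H} (hz : z ≠ 0) :
    t * z ∈ hadd (x * z) (y * z) ↔ t ∈ hadd x y := by
  refine ⟨fun h => ?_, fun h => mul_mem_hadd h z⟩
  obtain ⟨w, hw⟩ := Hyperfield.exists_mul_eq_one z hz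
  simpa [mul_assoc, hw] using mul_mem_hadd h w

lemma neg_mem_hadd {x y t : H} (h : t ∈ hadd x y) : -t ∈ hadd (-x) (-y) := by
  simpa [mul_comm _ (-1 : H), hyp_neg_one_mul] using mul_mem_hadd h (-1)

lemma neg_mul_hyp (x y : H) : -x * y = -(x * y) := by
  rw [← hyp_neg_one_mul, mul_assoc, hyp_neg_one_mul]

lemma zero_hadd (x : H) : hadd 0 x = {x} := by rw [hadd_comm, hadd_zero]

lemma hyperDist_zero_left (x : H) : hyperDist val 0 x = val x := by
  by_cases hx : x = 0
  · rw [hx, hyperDist_self, hyp_val_zero]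
  · rw [hyperDist_eq (z := -x) (Ne.symm hx) (by rw [zero_hadd]; rfl), hyp_val_neg]

lemma hyperDist_mul_right (x y z : H) :
    hyperDist val (x * z) (y * z) = hyperDist val x y * val z := by
  by_cases hz : z = 0
  · rw [hz, mul_comm x, mul_comm y, hyp_zero_mul, hyp_zero_mul, hyperDist_self, hyp_val_zero,
      mul_zero]
  by_cases hxy : x = y
  · rw [hxy, hyperDist_self, hyperDist_self, zero_mul]
  obtain ⟨w, hw⟩ := hyp_hadd_nonempty x (-y)
  have h := mul_mem_hadd hw z
  rw [neg_mul_hyp] at h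
  rw [hyperDist_eq (fun h => hxy (mul_right_cancel_of_ne_zero hz h)) h, hyperDist_eq hxy hw,
    val_mul]

lemma val_le_max_hyperDist (x y : H) : val x ≤ max (val y) (hyperDist val y x) := by
  have := hyperDist_ultra 0 y x
  rwa [hyperDist_zero_left, hyperDist_zero_left] at this

lemma hyperDist_mem_range (x y : H) : ∃ z : H, val z = hyperDist val x y := by
  by_cases hxy : x = y
  · exact ⟨0, by rw [hxy, hyperDist_self, hyp_val_zero]⟩
  · obtain ⟨w, hw⟩ := hyp_hadd_nonempty x (-y)
    exact ⟨w, (hyperDist_eq hxy hw).symm⟩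

lemma mem_integers {x : H} : x ∈ integers H ↔ val x ≤ 1 := by
  rw [integers, hyperClosedBall, Set.mem_ofPred_eq, hyperDist_zero_left]

lemma mem_maxIdeal {x : H} : x ∈ maxIdeal H ↔ val x ≤ theta H := by
  rw [maxIdeal, hyperClosedBall, Set.mem_ofPred_eq, hyperDist_zero_left]

end Basic

/-! ### The value group of a discretely valued hyperfield -/

section Discrete

variable {H : Type u} [ValuedHyperfield H] (hd : IsDiscretelyValued H)

include hd

lemma IsDiscretelyValued.exists_val_lt {ε : ℝ} (hε : 0 < ε) : ∃ x : H, x ≠ 0 ∧ val x < ε := by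
  have h := (hd 0 ⟨0, hyp_val_zero⟩).2 rfl
  rw [accPt_iff_nhds] at h
  obtain ⟨_, ⟨hy, x, rfl⟩, hx⟩ := h _ (Metric.ball_mem_nhds 0 hε)
  refine ⟨x, fun h0 => hx (by rw [h0, hyp_val_zero]), ?_⟩
  rw [Metric.mem_ball, Real.dist_eq, sub_zero] at hy
  exact lt_of_abs_lt hy

/-- The value `1` is isolated. Applied to quotients of elements, this becomes a uniform bound on the
ratio of two distinct values. -/
lemma IsDiscretelyValued.exists_gap :
    ∃ ε : ℝ, 0 < ε ∧ ε < 1 ∧ ∀ x : H, val x < 1 → val x ≤ 1 - ε := by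
  have h : ¬ AccPt (1 : ℝ) (Filter.principal (Set.range (val : H → ℝ))) := fun h =>
    one_ne_zero ((hd 1 ⟨1, hyp_val_one⟩).1 h)
  rw [accPt_iff_nhds] at h
  push Not at h
  obtain ⟨U, hU, h⟩ := h
  obtain ⟨ε, hε, hb⟩ := Metric.mem_nhds_iff.1 hU
  refine ⟨min ε (1 / 2), by positivity, (min_le_right _ _).trans_lt (by norm_num), fun x hx => ?_⟩
  by_contra! hlt
  have hm := min_le_left ε (1 / 2)
  refine hx.ne (h _ ⟨hb ?_, x, rfl⟩)
  rw [Metric.mem_ball, Real.dist_eq, abs_lt]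
  constructor <;> linarith

lemma IsDiscretelyValued.isGreatest_theta :
    IsGreatest {a : ℝ | a < 1 ∧ ∃ x : H, x ≠ 0 ∧ val x = a} (theta H) := by
  set S := {a : ℝ | a < 1 ∧ ∃ x : H, x ≠ 0 ∧ val x = a}
  obtain ⟨x, hx, hx1⟩ := hd.exists_val_lt one_pos
  have hne : S.Nonempty := ⟨_, hx1, x, hx, rfl⟩
  have hb : BddAbove S := ⟨1, fun a ha => ha.1.le⟩
  refine ⟨?_, fun a ha => le_csSup hb ha⟩
  obtain ⟨ε, hε, hε1, hgap⟩ := hd.exists_gap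
  have hpos : 0 < theta H := (val_pos hx).trans_le (le_csSup hb ⟨hx1, x, hx, rfl⟩)
  -- If the supremum were not attained, there would be values `|y| < |z|` above `θ (1 - ε)`, and the
  -- ratio `|y| / |z|` would fall in the gap below `1`.
  obtain ⟨_, ⟨ha1, y, hy, rfl⟩, hlt⟩ :=
    exists_lt_of_lt_csSup hne (show theta H * (1 - ε) < sSup S by
      change _ < theta H; nlinarith)
  rcases (le_csSup hb ⟨ha1, y, hy, rfl⟩ : val y ≤ theta H).lt_or_eq with h | h
  · obtain ⟨_, ⟨hb1, z, hz, rfl⟩, hlt'⟩ := exists_lt_of_lt_csSup hne h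
    obtain ⟨a, -, ha⟩ := exists_eq_mul y hz
    have hzpos := val_pos hz
    have h1 : val a ≤ 1 - ε := hgap a (by rw [ha, div_lt_one hzpos]; exact hlt')
    rw [ha, div_le_iff₀ hzpos] at h1
    have : val z ≤ theta H := le_csSup hb ⟨hb1, z, hz, rfl⟩
    nlinarith
  · exact ⟨(show theta H = val y from h.symm).trans_lt ha1, y, hy, h⟩

lemma IsDiscretelyValued.theta_lt_one : theta H < 1 := hd.isGreatest_theta.1.1

lemma IsDiscretelyValued.exists_uniformizer : ∃ x : H, IsUniformizer x :=
  let ⟨x, _, hx⟩ := hd.isGreatest_theta.1.2; ⟨x, hx⟩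

lemma IsDiscretelyValued.theta_pos : 0 < theta H := by
  obtain ⟨x, hx, h⟩ := hd.isGreatest_theta.1.2
  rw [← h]
  exact val_pos hx

lemma IsDiscretelyValued.uniformizer_ne_zero {x : H} (hx : IsUniformizer x) : x ≠ 0 :=
  ne_zero_of_val_pos (by rw [show val x = theta H from hx]; exact hd.theta_pos)

lemma IsDiscretelyValued.val_le_theta {x : H} (hx : val x < 1) : val x ≤ theta H := by
  by_cases h0 : x = 0
  · rw [h0, hyp_val_zero]; exact hd.theta_pos.le
  · exact hd.isGreatest_theta.2 ⟨hx, x, h0, rfl⟩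

lemma IsDiscretelyValued.exists_val_eq_zpow (n : ℤ) : ∃ x : H, val x = theta H ^ n := by
  obtain ⟨ϖ, hϖ⟩ := hd.exists_uniformizer
  obtain ⟨y, -, hy⟩ := exists_val_eq_inv (hd.uniformizer_ne_zero hϖ)
  obtain ⟨m, rfl | rfl⟩ := n.eq_nat_or_neg
  · exact ⟨ϖ ^ m, by rw [val_pow, show val ϖ = theta H from hϖ, zpow_natCast]⟩
  · exact ⟨y ^ m, by
      rw [val_pow, hy, show val ϖ = theta H from hϖ, zpow_neg, zpow_natCast, inv_pow]⟩

lemma IsDiscretelyValued.exists_zpow_lt_le {a : ℝ} (ha : 0 < a) :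
    ∃ n : ℤ, theta H ^ (n + 1) < a ∧ a ≤ theta H ^ n := by
  obtain ⟨n, h1, h2⟩ := exists_mem_Ioc_zpow ha ((one_lt_inv₀ hd.theta_pos).2 hd.theta_lt_one)
  refine ⟨-(n + 1), ?_, ?_⟩
  · rw [neg_add, neg_add_cancel_right, ← inv_zpow']; exact h1
  · rw [← inv_zpow']; exact h2

/-- After division by a suitable power of a uniformizer the value lies in `(θ, 1]`, where `1` is the
only possibility. -/
lemma IsDiscretelyValued.exists_zpow_eq_val {x : H} (hx : x ≠ 0) :
    ∃ n : ℤ, val x = theta H ^ n := by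
  obtain ⟨n, h1, h2⟩ := hd.exists_zpow_lt_le (val_pos hx)
  obtain ⟨y, hy⟩ := hd.exists_val_eq_zpow n
  have hpos := zpow_pos hd.theta_pos n
  obtain ⟨a, -, ha⟩ := exists_eq_mul x (ne_zero_of_val_pos (by rw [hy]; exact hpos))
  rw [hy] at ha
  refine ⟨n, h2.antisymm ?_⟩
  by_contra! hlt
  have h3 := hd.val_le_theta (x := a) (by rw [ha, div_lt_one hpos]; exact hlt)
  rw [ha, div_le_iff₀ hpos, ← zpow_one_add₀ hd.theta_pos.ne', add_comm] at h3
  exact absurd h1 h3.not_gt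

lemma IsDiscretelyValued.val_le_zpow_of_lt {x : H} {n : ℤ} (h : val x < theta H ^ n) :
    val x ≤ theta H ^ (n + 1) := by
  by_cases h0 : x = 0
  · rw [h0, hyp_val_zero]; exact (zpow_pos hd.theta_pos _).le
  obtain ⟨m, hm⟩ := hd.exists_zpow_eq_val h0
  rw [hm] at h ⊢
  rw [zpow_lt_zpow_iff_right_of_lt_one₀ hd.theta_pos hd.theta_lt_one] at h
  rw [zpow_le_zpow_iff_right_of_lt_one₀ hd.theta_pos hd.theta_lt_one]
  omega

/-- In a discretely valued hyperfield, all sums are closed balls of radius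
`θ_H ^ k * max |x| |y|` for a suitable `k ≥ 1`. -/
lemma IsDiscretelyValued.exists_hadd_eq_closedBall : ∃ k : ℕ, 1 ≤ k ∧
    ∀ x y : H, ∃ c : H,
      hadd x y = hyperClosedBall val c (theta H ^ k * max (val x) (val y)) := by
  obtain ⟨ρ, hρ, hB⟩ := sumsAreBalls (H := H)
  have hθ := hd.theta_pos
  have hθ1 := hd.theta_lt_one
  suffices h : ∃ k : ℤ, ∀ x y : H, ∃ c : H,
      hadd x y = hyperClosedBall val c (theta H ^ k * max (val x) (val y)) by
    obtain ⟨k, hk⟩ := h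
    -- The ball `1 + 0 = {1}` omits `0`, which is at distance `1` from its only element; hence its
    -- radius `θ ^ k` is less than `1`.
    have hk1 : 1 ≤ k := by
      obtain ⟨c, hc⟩ := hk 1 0
      rw [hadd_zero, hyp_val_one, hyp_val_zero, max_eq_left zero_le_one, mul_one] at hc
      have h1 : (1 : H) ∈ hyperClosedBall val c (theta H ^ k) := hc ▸ rfl
      have h0 : (0 : H) ∉ hyperClosedBall val c (theta H ^ k) := by
        rw [← hc]; exact Hyperfield.zero_ne_one
      rw [mem_hyperClosedBall_of_mem h1, hyperClosedBall, Set.mem_ofPred_eq, hyperDist_comm,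
        hyperDist_zero_left, hyp_val_one, not_le, ← zpow_zero (theta H),
        zpow_lt_zpow_iff_right_of_lt_one₀ hθ hθ1] at h0
      omega
    lift k to ℕ using by omega
    exact ⟨k, by omega, fun x y => by simpa using hk x y⟩
  have hmax : ∀ x y : H, (x = 0 ∧ y = 0) ∨ ∃ m : ℤ, max (val x) (val y) = theta H ^ m := by
    intro x y
    by_cases h0 : x = 0 ∧ y = 0
    · exact Or.inl h0
    obtain ⟨w, hw⟩ : ∃ w : H, max (val x) (val y) = val w := by
      rcases le_total (val x) (val y) with h | h
      · exact ⟨y, max_eq_right h⟩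
      · exact ⟨x, max_eq_left h⟩
    refine Or.inr (hw ▸ hd.exists_zpow_eq_val ?_)
    rintro rfl
    rw [hyp_val_zero] at hw
    refine h0 ⟨?_, ?_⟩ <;> refine (val_eq_zero_iff _).1 (le_antisymm ?_ (val_nonneg _))
    · exact hw ▸ le_max_left _ _
    · exact hw ▸ le_max_right _ _
  -- The sum `0 + 0` has radius zero and is excluded from the open form of the axiom, so it is
  -- handled separately.
  have hzero : ∀ a : ℝ, hadd (0 : H) 0 =
      hyperClosedBall val 0 (a * max (val (0 : H)) (val (0 : H))) := by
    intro a
    ext z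
    rw [hadd_zero, hyp_val_zero, max_self, mul_zero, Set.mem_singleton_iff, hyperClosedBall,
      Set.mem_ofPred_eq, hyperDist_zero_left]
    exact ⟨fun h => by rw [h, hyp_val_zero],
      fun h => (val_eq_zero_iff _).1 (le_antisymm h (val_nonneg _))⟩
  obtain ⟨n, h1, h2⟩ := hd.exists_zpow_lt_le hρ
  rcases hB with hB | hB
  · -- closed balls
    -- Rounding `ρ` down to a power of `θ` changes no ball, because no distance lies between the two
    -- radii.
    have key : ∃ k : ℤ, theta H ^ k ≤ ρ ∧ ρ < theta H ^ (k - 1) := by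
      rcases h2.lt_or_eq with h | h
      · exact ⟨n + 1, h1.le, by simpa using h⟩
      · refine ⟨n, h.ge, ?_⟩
        rw [h, zpow_lt_zpow_iff_right_of_lt_one₀ hθ hθ1]
        omega
    obtain ⟨k, hk1, hk2⟩ := key
    refine ⟨k, fun x y => ?_⟩
    rcases hmax x y with ⟨rfl, rfl⟩ | ⟨m, hm⟩
    · exact ⟨0, hzero _⟩
    obtain ⟨c, hc⟩ := hB x y
    refine ⟨c, ?_⟩
    rw [hc, hm]
    ext z
    simp only [hyperClosedBall, Set.mem_ofPred_eq]
    have hpos := zpow_pos hθ m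
    refine ⟨fun h => ?_, fun h => h.trans (by gcongr)⟩
    obtain ⟨w, hw⟩ := hyperDist_mem_range c z
    rw [← hw] at h ⊢
    have := hd.val_le_zpow_of_lt (x := w) (n := k - 1 + m)
      (by rw [zpow_add₀ hθ.ne']; exact h.trans_lt (by gcongr))
    rwa [← zpow_add₀ hθ.ne', show k + m = k - 1 + m + 1 by ring]
  -- For open balls, distances below `ρ θ ^ m ≤ θ ^ (n + m)` are at most `θ ^ (n + 1 + m)`; this
  -- covers the case `ρ = θ ^ n` as well.
  · refine ⟨n + 1, fun x y => ?_⟩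
    rcases hmax x y with ⟨rfl, rfl⟩ | ⟨m, hm⟩
    · exact ⟨0, hzero _⟩
    have hxy : x ≠ 0 ∨ y ≠ 0 := by
      by_contra! hcon
      rw [hcon.1, hcon.2, max_self, hyp_val_zero] at hm
      exact (zpow_pos hθ m).ne hm
    obtain ⟨c, hc⟩ := hB x y hxy
    refine ⟨c, ?_⟩
    rw [hc, hm]
    ext z
    simp only [hyperClosedBall, hyperOpenBall, Set.mem_ofPred_eq]
    have hpos := zpow_pos hθ m
    refine ⟨fun h => ?_, fun h => h.trans_lt (by gcongr)⟩
    obtain ⟨w, hw⟩ := hyperDist_mem_range c z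
    rw [← hw] at h ⊢
    have := hd.val_le_zpow_of_lt (x := w) (n := n + m)
      (by rw [zpow_add₀ hθ.ne']; exact h.trans_le (by gcongr))
    rwa [← zpow_add₀ hθ.ne', show n + 1 + m = n + m + 1 by ring]

/-- The norm `ρ_H` is a positive power of `θ_H`, and the sums are closed balls for it. -/
lemma IsDiscretelyValued.exists_krasnerNorm_eq_pow : ∃ k : ℕ, 1 ≤ k ∧
    krasnerNorm H = theta H ^ k ∧
    ∀ x y : H, ∃ c : H,
      hadd x y = hyperClosedBall val c (krasnerNorm H * max (val x) (val y)) := by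
  obtain ⟨k, hk, hB⟩ := hd.exists_hadd_eq_closedBall
  suffices h : krasnerNorm H = theta H ^ k from ⟨k, hk, h, by rwa [h]⟩
  refine IsLeast.csInf_eq ⟨⟨pow_pos hd.theta_pos k, Or.inl hB⟩, ?_⟩
  rintro ρ ⟨hρ, hρB⟩
  have h11 : hadd (1 : H) (-1) = hyperClosedBall val 0 (theta H ^ k) := by
    obtain ⟨c, hc⟩ := hB 1 (-1)
    rw [hyp_val_neg, max_self, hyp_val_one, mul_one] at hc
    have h0 := zero_mem_hadd_neg (1 : H)
    rw [hc] at h0 ⊢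
    ext z
    exact mem_hyperClosedBall_of_mem h0
  -- The difference `1 - 1` is a ball around `0`, and it contains an element of value exactly `θ ^
  -- k`. No admissible `ρ` can therefore be smaller.
  obtain ⟨z, hz⟩ := hd.exists_val_eq_zpow k
  rw [zpow_natCast] at hz
  have hz1 : z ∈ hadd (1 : H) (-1) := by
    rw [h11, hyperClosedBall, Set.mem_ofPred_eq, hyperDist_zero_left, hz]
  have h0 := zero_mem_hadd_neg (1 : H)
  rcases hρB with h | h
  · obtain ⟨c, hc⟩ := h 1 (-1)
    rw [hyp_val_neg, max_self, hyp_val_one, mul_one] at hc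
    rw [hc] at h0 hz1
    rw [mem_hyperClosedBall_of_mem h0, hyperClosedBall, Set.mem_ofPred_eq, hyperDist_zero_left,
      hz] at hz1
    exact hz1
  · obtain ⟨c, hc⟩ := h 1 (-1) (Or.inl (Ne.symm Hyperfield.zero_ne_one))
    rw [hyp_val_neg, max_self, hyp_val_one, mul_one] at hc
    rw [hc] at h0 hz1
    rw [mem_hyperOpenBall_of_mem h0, hyperOpenBall, Set.mem_ofPred_eq, hyperDist_zero_left,
      hz] at hz1
    exact hz1.le

lemma IsDiscretelyValued.krasnerNorm_pos : 0 < krasnerNorm H := by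
  obtain ⟨k, -, h, -⟩ := hd.exists_krasnerNorm_eq_pow
  rw [h]
  exact pow_pos hd.theta_pos k

lemma IsDiscretelyValued.krasnerNorm_lt_one : krasnerNorm H < 1 := by
  obtain ⟨k, hk, h, -⟩ := hd.exists_krasnerNorm_eq_pow
  rw [h]
  exact pow_lt_one₀ hd.theta_pos.le hd.theta_lt_one (by omega)

lemma IsDiscretelyValued.mem_hadd_iff {x y z w : H} (hz : z ∈ hadd x y) :
    w ∈ hadd x y ↔ hyperDist val z w ≤ krasnerNorm H * max (val x) (val y) := by
  obtain ⟨k, -, -, hB⟩ := hd.exists_krasnerNorm_eq_pow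
  obtain ⟨c, hc⟩ := hB x y
  rw [hc] at hz ⊢
  exact mem_hyperClosedBall_of_mem hz

/-- The singleton `x + 0` is itself a ball of radius `ρ_H |x|`. This rigidity is the source of
faithfulness. -/
lemma IsDiscretelyValued.eq_of_hyperDist_le {x y : H}
    (h : hyperDist val x y ≤ krasnerNorm H * val x) : x = y := by
  have hx : x ∈ hadd x 0 := by rw [hadd_zero]; rfl
  have hy : y ∈ hadd x 0 := by
    rwa [hd.mem_hadd_iff hx, hyp_val_zero, max_eq_left (val_nonneg x)]
  rw [hadd_zero] at hy
  exact hy.symm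

lemma IsDiscretelyValued.mem_sub_self_iff {x w : H} :
    w ∈ hadd x (-x) ↔ val w ≤ krasnerNorm H * val x := by
  rw [hd.mem_hadd_iff (zero_mem_hadd_neg x), hyperDist_zero_left, hyp_val_neg, max_self]

/-- For `x ≠ y` the bound is the definition of the distance. For `x = y` the distance is zero
although `x - x` has nonzero elements; these are controlled by the ball axiom and `|x| ≤ s`. -/
lemma IsDiscretelyValued.val_le_of_mem_sub {x y w : H} {s : ℝ} (hx : val x ≤ s)
    (h : hyperDist val x y ≤ krasnerNorm H * s) (hw : w ∈ hadd x (-y)) :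
    val w ≤ krasnerNorm H * s := by
  by_cases hxy : x = y
  · subst hxy
    have := hd.krasnerNorm_pos
    exact (hd.mem_sub_self_iff.1 hw).trans (by gcongr)
  · rwa [← hyperDist_eq hxy hw]

/-- Sums are compatible with congruences. -/
lemma IsDiscretelyValued.hyperDist_le_of_mem_hadd {x x' y y' z z' : H} {s : ℝ}
    (hx : val x ≤ s) (hy : val y ≤ s) (hxx : hyperDist val x x' ≤ krasnerNorm H * s)
    (hyy : hyperDist val y y' ≤ krasnerNorm H * s) (hz : z ∈ hadd x y) (hz' : z' ∈ hadd x' y') :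
    hyperDist val z z' ≤ krasnerNorm H * s := by
  -- find `w ∈ z - z'` in `(x - x') + (y - y')`
  have hx'' : x ∈ hadd z (-y) := (mem_hadd_neg_iff _ _ _).2 hz
  obtain ⟨w, hw⟩ := hyp_hadd_nonempty z (-z')
  -- `w ∈ (x + y) - z' = x + (y - z')`
  have h1 : w ∈ ⋃ t ∈ hadd x y, hadd t (-z') := by
    simp only [Set.mem_iUnion]; exact ⟨z, hz, hw⟩
  rw [hadd_assoc] at h1
  simp only [Set.mem_iUnion] at h1
  obtain ⟨t, ht, hwt⟩ := h1
  -- `t ∈ y + (-x' - y') = (y - y') - x'`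
  have h2 : t ∈ ⋃ b ∈ hadd (-y') (-x'), hadd y b := by
    simp only [Set.mem_iUnion]
    exact ⟨-z', by rw [hadd_comm]; exact neg_mem_hadd hz', ht⟩
  rw [← hadd_assoc] at h2
  simp only [Set.mem_iUnion] at h2
  obtain ⟨b, hb, htb⟩ := h2
  have h3 : w ∈ ⋃ c ∈ hadd (-x') b, hadd x c := by
    simp only [Set.mem_iUnion]
    exact ⟨t, by rwa [hadd_comm], hwt⟩
  rw [← hadd_assoc] at h3
  simp only [Set.mem_iUnion] at h3
  obtain ⟨a, ha, hwa⟩ := h3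
  exact (hyperDist_le hw).trans ((val_le_max _ _ _ hwa).trans
    (max_le (hd.val_le_of_mem_sub hx hxx ha) (hd.val_le_of_mem_sub hy hyy hb)))

end Discrete

end ValuedHyperfield

/-! ### The triple of a discretely valued hyperfield -/

namespace DVHyp

variable (H : DVHyp.{u})

lemma krasnerNorm_nonneg : 0 ≤ krasnerNorm H.carrier :=
  H.discretelyValued.krasnerNorm_pos.le

/-- Congruence modulo `ρ_H` on `𝒪_H`. -/
def residueSetoid : Setoid (integers H.carrier) where
  r x y := congrMod (krasnerNorm H.carrier) (x : H.carrier) (y : H.carrier)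
  iseqv :=
    { refl := fun x => by rw [congrMod, hyperDist_self]; exact H.krasnerNorm_nonneg
      symm := fun h => by rwa [congrMod, hyperDist_comm]
      trans := fun h h' => (hyperDist_ultra _ _ _).trans (max_le h h') }

/-- The ring `𝒪_H / ≡_{ρ_H}`. -/
def ResidueRing : Type u := Quotient H.residueSetoid

variable {H}

/-! ### Ring structure and locality of the residue ring. -/

namespace ResidueRing

/-- The reduction map `𝒪_H → 𝒪_H / ≡_{ρ_H}`. -/
def residue (x : integers H.carrier) : H.ResidueRing := Quotient.mk H.residueSetoid x

lemma residue_surjective : Function.Surjective (residue (H := H)) := Quotient.mk_surjective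

lemma residue_eq_iff {x y : integers H.carrier} :
    residue x = residue y ↔ congrMod (krasnerNorm H.carrier) (x : H.carrier) (y : H.carrier) :=
  Quotient.eq (r := H.residueSetoid)

lemma residue_eq_iff_hyperDist {x y : integers H.carrier} :
    residue x = residue y ↔ hyperDist val (x : H.carrier) y ≤ krasnerNorm H.carrier :=
  residue_eq_iff

lemma val_le_one (x : integers H.carrier) : val (x : H.carrier) ≤ 1 := mem_integers.1 x.2

lemma exists_mem_hadd (x y : integers H.carrier) :
    ∃ z : integers H.carrier, (z : H.carrier) ∈ hadd (x : H.carrier) y := by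
  obtain ⟨z, hz⟩ := hyp_hadd_nonempty (x : H.carrier) y
  exact ⟨⟨z, mem_integers.2 ((val_le_max _ _ _ hz).trans (max_le (val_le_one x) (val_le_one y)))⟩,
    hz⟩

/-- The product of two integers. -/
def mulInt (x y : integers H.carrier) : integers H.carrier :=
  ⟨x * y, mem_integers.2 (by
    rw [val_mul]; exact mul_le_one₀ (val_le_one x) (val_nonneg _) (val_le_one y))⟩

/-- This is the case `s = 1` of the general congruence. It gives independence of the representatives
and, for equal summands, independence of the element picked from the sum. -/
lemma hyperDist_le_of_mem_hadd {x x' y y' z z' : integers H.carrier} (hx : residue x = residue x')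
    (hy : residue y = residue y') (hz : (z : H.carrier) ∈ hadd (x : H.carrier) y)
    (hz' : (z' : H.carrier) ∈ hadd (x' : H.carrier) y') : residue z = residue z' := by
  rw [residue_eq_iff_hyperDist] at *
  have := H.discretelyValued.hyperDist_le_of_mem_hadd (s := 1) (val_le_one x) (val_le_one y)
    (by rwa [mul_one]) (by rwa [mul_one]) hz hz'
  rwa [mul_one] at this

noncomputable instance : Add H.ResidueRing :=
  ⟨Quotient.map₂ (fun x y => (exists_mem_hadd x y).choose) fun _ _ h _ _ h' =>
    Quotient.exact (hyperDist_le_of_mem_hadd (Quotient.sound h) (Quotient.sound h')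
      (exists_mem_hadd _ _).choose_spec (exists_mem_hadd _ _).choose_spec)⟩

instance : Zero H.ResidueRing :=
  ⟨residue ⟨0, mem_integers.2 (by rw [hyp_val_zero]; exact zero_le_one)⟩⟩

instance : One H.ResidueRing := ⟨residue ⟨1, mem_integers.2 (by rw [hyp_val_one])⟩⟩

instance : Neg H.ResidueRing :=
  ⟨Quotient.map (fun x => ⟨-x, mem_integers.2 (by rw [hyp_val_neg]; exact val_le_one x)⟩)
    fun x y (h : hyperDist _ _ _ ≤ _) => by
      change hyperDist val (-(x : H.carrier)) (-y) ≤ _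
      rw [← hyp_neg_one_mul, ← hyp_neg_one_mul (y : H.carrier), mul_comm,
        mul_comm _ (y : H.carrier), hyperDist_mul_right, hyp_val_neg, hyp_val_one, mul_one]
      exact h⟩

instance : Mul H.ResidueRing :=
  ⟨Quotient.map₂ mulInt fun x x' (h : hyperDist _ _ _ ≤ _) y y' (h' : hyperDist _ _ _ ≤ _) => by
    change hyperDist val ((x : H.carrier) * y) (x' * y') ≤ _
    refine (hyperDist_ultra _ ((x' : H.carrier) * y) _).trans (max_le ?_ ?_)
    · rw [hyperDist_mul_right]
      exact (mul_le_of_le_one_right (hyperDist_nonneg _ _) (val_le_one y)).trans h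
    · rw [mul_comm, mul_comm _ (y' : H.carrier), hyperDist_mul_right]
      exact (mul_le_of_le_one_right (hyperDist_nonneg _ _) (val_le_one x')).trans h'⟩

lemma residue_add {x y z : integers H.carrier} (h : (z : H.carrier) ∈ hadd (x : H.carrier) y) :
    residue z = residue x + residue y :=
  hyperDist_le_of_mem_hadd rfl rfl h (exists_mem_hadd _ _).choose_spec

lemma residue_mul {x y z : integers H.carrier} (h : (z : H.carrier) = x * y) :
    residue z = residue x * residue y :=
  congrArg residue (Subtype.ext h)

lemma residue_one {x : integers H.carrier} (h : (x : H.carrier) = 1) : residue x = 1 :=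
  congrArg residue (Subtype.ext h)

lemma residue_mul_residue (x y : integers H.carrier) :
    residue x * residue y = residue (mulInt x y) := rfl

protected lemma add_comm (a b : H.ResidueRing) : a + b = b + a := by
  obtain ⟨x, rfl⟩ := residue_surjective a
  obtain ⟨y, rfl⟩ := residue_surjective b
  obtain ⟨z, hz⟩ := exists_mem_hadd x y
  rw [← residue_add hz, ← residue_add (by rwa [hadd_comm])]

protected lemma add_assoc (a b c : H.ResidueRing) : a + b + c = a + (b + c) := by
  obtain ⟨x, rfl⟩ := residue_surjective a
  obtain ⟨y, rfl⟩ := residue_surjective b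
  obtain ⟨z, rfl⟩ := residue_surjective c
  obtain ⟨s, hs⟩ := exists_mem_hadd x y
  obtain ⟨t, ht⟩ := exists_mem_hadd s z
  have h : (t : H.carrier) ∈ ⋃ w ∈ hadd (x : H.carrier) y, hadd w z := by
    simp only [Set.mem_iUnion]
    exact ⟨s, hs, ht⟩
  rw [hadd_assoc] at h
  simp only [Set.mem_iUnion] at h
  obtain ⟨w, hw, htw⟩ := h
  lift w to integers H.carrier using
    mem_integers.2 ((val_le_max _ _ _ hw).trans (max_le (val_le_one y) (val_le_one z)))
  rw [← residue_add hs, ← residue_add ht, ← residue_add hw, ← residue_add htw]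

protected lemma zero_add (a : H.ResidueRing) : 0 + a = a := by
  obtain ⟨x, rfl⟩ := residue_surjective a
  exact (residue_add (by rw [zero_hadd]; rfl)).symm

protected lemma mul_comm (a b : H.ResidueRing) : a * b = b * a := by
  obtain ⟨x, rfl⟩ := residue_surjective a
  obtain ⟨y, rfl⟩ := residue_surjective b
  exact congrArg residue (Subtype.ext (mul_comm _ _))

protected lemma one_mul (a : H.ResidueRing) : 1 * a = a := by
  obtain ⟨x, rfl⟩ := residue_surjective a
  exact congrArg residue (Subtype.ext (one_mul _))

protected lemma zero_mul (a : H.ResidueRing) : 0 * a = 0 := by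
  obtain ⟨x, rfl⟩ := residue_surjective a
  exact congrArg residue (Subtype.ext (hyp_zero_mul _))

protected lemma add_mul (a b c : H.ResidueRing) : (a + b) * c = a * c + b * c := by
  obtain ⟨x, rfl⟩ := residue_surjective a
  obtain ⟨y, rfl⟩ := residue_surjective b
  obtain ⟨z, rfl⟩ := residue_surjective c
  obtain ⟨s, hs⟩ := exists_mem_hadd x y
  rw [← residue_add hs]
  exact residue_add (mul_mem_hadd hs _)

noncomputable instance : CommRing H.ResidueRing where
  add_assoc := ResidueRing.add_assoc
  zero_add := ResidueRing.zero_add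
  add_zero a := by rw [ResidueRing.add_comm, ResidueRing.zero_add]
  nsmul := nsmulRec
  zsmul := zsmulRec
  add_comm := ResidueRing.add_comm
  neg_add_cancel a := by
    obtain ⟨x, rfl⟩ := residue_surjective a
    rw [ResidueRing.add_comm]
    exact (residue_add (zero_mem_hadd_neg (x : H.carrier))).symm
  mul_assoc a b c := by
    obtain ⟨x, rfl⟩ := residue_surjective a
    obtain ⟨y, rfl⟩ := residue_surjective b
    obtain ⟨z, rfl⟩ := residue_surjective c
    exact congrArg residue (Subtype.ext (mul_assoc _ _ _))
  mul_comm := ResidueRing.mul_comm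
  one_mul := ResidueRing.one_mul
  mul_one a := by rw [ResidueRing.mul_comm, ResidueRing.one_mul]
  zero_mul := ResidueRing.zero_mul
  mul_zero a := by rw [ResidueRing.mul_comm, ResidueRing.zero_mul]
  left_distrib a b c := by
    rw [ResidueRing.mul_comm, ResidueRing.add_mul, ResidueRing.mul_comm a,
      ResidueRing.mul_comm a]
  right_distrib := ResidueRing.add_mul

lemma residue_eq_zero_iff {x : integers H.carrier} :
    residue x = 0 ↔ val (x : H.carrier) ≤ krasnerNorm H.carrier := by
  rw [← hyperDist_zero_left, hyperDist_comm]
  exact residue_eq_iff_hyperDist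

instance : Nontrivial H.ResidueRing := by
  refine ⟨1, 0, fun h => ?_⟩
  have := residue_eq_zero_iff.1 h
  rw [hyp_val_one] at this
  exact absurd H.discretelyValued.krasnerNorm_lt_one this.not_gt

lemma isUnit_residue_iff {x : integers H.carrier} :
    IsUnit (residue x) ↔ val (x : H.carrier) = 1 := by
  constructor
  · intro h
    obtain ⟨b, hb⟩ := h.exists_right_inv
    obtain ⟨y, rfl⟩ := residue_surjective b
    rw [residue_mul_residue, eq_comm] at hb
    have h1 : hyperDist val 1 ((x : H.carrier) * y) ≤ krasnerNorm H.carrier :=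
      residue_eq_iff_hyperDist.1 hb
    have h2 := val_le_max_hyperDist (1 : H.carrier) (x * y)
    rw [hyp_val_one, hyperDist_comm] at h2
    have h3 := H.discretelyValued.krasnerNorm_lt_one
    -- Since `ρ_H < 1`, an element congruent to `1` cannot have value below `1`.
    have h4 : 1 ≤ val ((x : H.carrier) * y) := by
      rcases le_max_iff.1 h2 with h | h
      · exact h
      · exact absurd (h.trans h1) h3.not_ge
    rw [val_mul] at h4
    have := val_le_one x
    have := val_le_one y
    have := val_nonneg (y : H.carrier)
    have := val_nonneg (x : H.carrier)
    nlinarith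
  · intro h
    obtain ⟨y, hy, hv⟩ := exists_val_eq_inv (ne_zero_of_val_pos (x := (x : H.carrier))
      (by rw [h]; exact one_pos))
    rw [h, inv_one] at hv
    exact IsUnit.of_mul_eq_one (residue ⟨y, mem_integers.2 hv.le⟩)
      ((residue_mul_residue _ _).trans (residue_one hy))

lemma mem_nonunits_residue_iff {x : integers H.carrier} :
    residue x ∈ nonunits H.ResidueRing ↔ val (x : H.carrier) ≤ theta H.carrier := by
  rw [mem_nonunits_iff, isUnit_residue_iff]
  exact ⟨fun h => H.discretelyValued.val_le_theta (lt_of_le_of_ne (val_le_one x) h),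
    fun h => (h.trans_lt H.discretelyValued.theta_lt_one).ne⟩

instance : IsLocalRing H.ResidueRing := by
  refine IsLocalRing.of_nonunits_add fun a b ha hb => ?_
  obtain ⟨x, rfl⟩ := residue_surjective a
  obtain ⟨y, rfl⟩ := residue_surjective b
  obtain ⟨z, hz⟩ := exists_mem_hadd x y
  rw [← residue_add hz]
  rw [mem_nonunits_residue_iff] at *
  exact (val_le_max _ _ _ hz).trans (max_le ha hb)

end ResidueRing

open ResidueRing

/-! ### Nilpotency of the uniformizer, and the triple with its reduction maps. -/

variable (H)

/-- A chosen uniformizer. -/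
noncomputable def uniformizer : H.carrier := H.discretelyValued.exists_uniformizer.choose

lemma val_uniformizer : val H.uniformizer = theta H.carrier :=
  H.discretelyValued.exists_uniformizer.choose_spec

lemma uniformizer_mem_integers : H.uniformizer ∈ integers H.carrier :=
  mem_integers.2 (H.val_uniformizer.trans_le H.discretelyValued.theta_lt_one.le)

/-- The class of the chosen uniformizer. -/
noncomputable def residueUniformizer : H.ResidueRing := residue ⟨_, H.uniformizer_mem_integers⟩

variable {H}

/-- The coefficient is the coordinate of `x` in the trivialization of `M` by the chosen uniformizer.
-/
lemma exists_coeff (x : maxIdeal H.carrier) :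
    ∃ a : integers H.carrier, (x : H.carrier) = a * H.uniformizer := by
  obtain ⟨a, ha, hv⟩ := exists_eq_mul (x : H.carrier)
    (H.discretelyValued.uniformizer_ne_zero H.val_uniformizer)
  refine ⟨⟨a, mem_integers.2 ?_⟩, ha⟩
  rw [hv, val_uniformizer]
  exact div_le_one_of_le₀ (mem_maxIdeal.1 x.2) H.discretelyValued.theta_pos.le

lemma maximalIdeal_residueRing :
    IsLocalRing.maximalIdeal H.ResidueRing = Ideal.span {H.residueUniformizer} := by
  ext a
  rw [IsLocalRing.mem_maximalIdeal, Ideal.mem_span_singleton']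
  constructor
  · intro ha
    obtain ⟨x, rfl⟩ := residue_surjective a
    obtain ⟨b, hb⟩ := exists_coeff (H := H) ⟨x, mem_maxIdeal.2 (mem_nonunits_residue_iff.1 ha)⟩
    exact ⟨residue b, (residue_mul hb).symm⟩
  · rintro ⟨b, rfl⟩
    refine mul_mem_nonunits_right ?_
    rw [residueUniformizer, mem_nonunits_residue_iff]
    exact H.val_uniformizer.le

/-- The exponent is the one with `ρ_H = θ_H ^ k`: the `k`-th power of a uniformizer has value `ρ_H`,
so it is congruent to zero. -/
lemma residueUniformizer_pow_eq_zero : ∃ k : ℕ, H.residueUniformizer ^ k = 0 := by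
  obtain ⟨k, -, hk, -⟩ := H.discretelyValued.exists_krasnerNorm_eq_pow
  refine ⟨k, ?_⟩
  have hmem : ∀ n : ℕ, H.uniformizer ^ n ∈ integers H.carrier := fun n => mem_integers.2 (by
    rw [val_pow, val_uniformizer]
    exact pow_le_one₀ H.discretelyValued.theta_pos.le H.discretelyValued.theta_lt_one.le)
  have h : ∀ n : ℕ, H.residueUniformizer ^ n = residue ⟨_, hmem n⟩ := by
    intro n
    induction n with
    | zero => exact (residue_one (pow_zero _)).symm
    | succ n ih => rw [pow_succ, ih]; exact (residue_mul (pow_succ _ _)).symm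
  rw [h, residue_eq_zero_iff, val_pow, val_uniformizer, hk]

instance : IsTruncatedDVR H.ResidueRing := by
  have hmax := maximalIdeal_residueRing (H := H)
  obtain ⟨k, hk⟩ := residueUniformizer_pow_eq_zero (H := H)
  have hnoeth : IsNoetherianRing H.ResidueRing := by
    -- By Cohen's theorem it suffices to look at primes. A prime contains the nilpotent generator,
    -- so it is the principal maximal ideal; nilpotency of this ideal then gives the Artinian
    -- property.
    refine IsNoetherianRing.of_prime fun I hI => ?_
    have ht : H.residueUniformizer ∈ I := hI.mem_of_pow_mem k (by rw [hk]; exact I.zero_mem)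
    have : I = Ideal.span {H.residueUniformizer} := by
      refine le_antisymm (hmax ▸ IsLocalRing.le_maximalIdeal hI.ne_top) ?_
      rwa [Ideal.span_singleton_le_iff_mem]
    rw [this]
    exact Submodule.fg_span_singleton _
  have hart : IsArtinianRing H.ResidueRing := by
    rw [isArtinianRing_iff_isNilpotent_maximalIdeal, hmax]
    refine ⟨k, ?_⟩
    rw [Ideal.span_singleton_pow, hk, Ideal.span_singleton_zero]
    rfl
  exact { isPrincipal_maximalIdeal := ⟨_, hmax⟩ }

variable (H)

/-- The triple of `H`.  The choice of a uniformizer trivializes its second component. -/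
noncomputable def triple : Triple.{u} where
  R := H.ResidueRing
  M := H.ResidueRing
  finrank_eq_one := Module.finrank_self _
  ε := LinearMap.toSpanSingleton _ _ H.residueUniformizer
  range_ε := by rw [LinearMap.range_toSpanSingleton, maximalIdeal_residueRing]

/-- The reduction maps onto the components of the triple of `H`. -/
noncomputable def tripleReduction : TripleReduction H.carrier H.triple where
  redR := residue
  redR_surjective := residue_surjective
  redR_eq_iff _ _ := residue_eq_iff
  redR_add _ _ _ := residue_add
  redR_mul _ _ _ := residue_mul
  redR_one _ := residue_one
  redM x := residue (exists_coeff x).choose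
  redM_surjective m := by
    obtain ⟨a, rfl⟩ := residue_surjective m
    have hx : (a : H.carrier) * H.uniformizer ∈ maxIdeal H.carrier := mem_maxIdeal.2 (by
      rw [val_mul, val_uniformizer]
      exact mul_le_of_le_one_left H.discretelyValued.theta_pos.le (val_le_one a))
    refine ⟨⟨_, hx⟩, congrArg residue (Subtype.ext ?_)⟩
    exact mul_right_cancel_of_ne_zero
      (H.discretelyValued.uniformizer_ne_zero H.val_uniformizer)
      (exists_coeff ⟨_, hx⟩).choose_spec.symm
  redM_eq_iff x y := by
    rw [congrMod]
    conv_rhs => rw [(exists_coeff x).choose_spec, (exists_coeff y).choose_spec]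
    -- Dividing by the uniformizer divides distances by `θ_H`, which turns the radius `θ_H ρ_H` into
    -- `ρ_H`.
    rw [hyperDist_mul_right, val_uniformizer, mul_comm (theta _),
      mul_le_mul_iff_of_pos_right H.discretelyValued.theta_pos]
    exact residue_eq_iff_hyperDist
  redM_add x y z h := by
    rw [(exists_coeff x).choose_spec, (exists_coeff y).choose_spec, (exists_coeff z).choose_spec,
      mul_mem_hadd_iff (H.discretelyValued.uniformizer_ne_zero H.val_uniformizer)] at h
    exact residue_add h
  redM_smul a x y h := by
    rw [(exists_coeff x).choose_spec, (exists_coeff y).choose_spec, ← mul_assoc] at h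
    exact residue_mul (mul_right_cancel_of_ne_zero
      (H.discretelyValued.uniformizer_ne_zero H.val_uniformizer) h)
  ε_redM x y h := by
    rw [(exists_coeff x).choose_spec] at h
    exact (residue_mul (x := (exists_coeff x).choose) (y := ⟨_, H.uniformizer_mem_integers⟩)
      h.symm).symm

end DVHyp

/-! ### Homomorphisms of discretely valued hyperfields -/

namespace ValuedHyperfieldHom

variable {H H' : DVHyp.{u}} (f : ValuedHyperfieldHom H.carrier H'.carrier)

lemma hyperDist_map_le (x y : H.carrier) :
    hyperDist val (f.toFun x) (f.toFun y) ≤ hyperDist val x y := by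
  by_cases h : f.toFun x = f.toFun y
  · rw [h, hyperDist_self]; exact hyperDist_nonneg _ _
  · exact (f.hyperDist_map h).le

-- The set `1 - 1` is the ball of radius `ρ` around `0`. An element of value `ρ_H` in it is mapped,
-- with the same value, into `1 - 1` in the target.
include f in
lemma krasnerNorm_le : krasnerNorm H.carrier ≤ krasnerNorm H'.carrier := by
  obtain ⟨k, -, hk, -⟩ := H.discretelyValued.exists_krasnerNorm_eq_pow
  obtain ⟨z, hz⟩ := H.discretelyValued.exists_val_eq_zpow k
  rw [zpow_natCast, ← hk] at hz
  have h1 : z ∈ hadd (1 : H.carrier) (-1) := by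
    rw [H.discretelyValued.mem_sub_self_iff, hz, hyp_val_one, mul_one]
  have h2 := f.map_mem_hadd h1
  rwa [f.map_neg', H'.discretelyValued.mem_sub_self_iff, f.val_map, hz, f.map_one', hyp_val_one,
    mul_one] at h2

-- The image of a uniformizer has value a power of `θ_{H'}`, and the exponent is positive because
-- this value is less than `1`.
include f in
lemma exists_theta_eq_pow : ∃ r : ℕ, 0 < r ∧ theta H.carrier = theta H'.carrier ^ r := by
  have hd := H.discretelyValued
  have hd' := H'.discretelyValued
  have hϖ := H.val_uniformizer
  rw [← f.val_map] at hϖ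
  obtain ⟨n, hn⟩ := hd'.exists_zpow_eq_val (x := f.toFun H.uniformizer)
    (ne_zero_of_val_pos (by rw [hϖ]; exact hd.theta_pos))
  rw [hn] at hϖ
  have h1 := hd.theta_lt_one
  rw [← hϖ, ← zpow_zero (theta H'.carrier),
    zpow_lt_zpow_iff_right_of_lt_one₀ hd'.theta_pos hd'.theta_lt_one] at h1
  lift n to ℕ using h1.le
  exact ⟨n, by exact_mod_cast h1, by rw [← hϖ, zpow_natCast]⟩

/-- The ramification index. -/
noncomputable def ramificationIndex : ℕ := f.exists_theta_eq_pow.choose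

lemma ramificationIndex_pos : 0 < f.ramificationIndex := f.exists_theta_eq_pow.choose_spec.1

lemma theta_eq_pow : theta H.carrier = theta H'.carrier ^ f.ramificationIndex :=
  f.exists_theta_eq_pow.choose_spec.2

lemma log_theta_ne_zero (H : DVHyp.{u}) : Real.log (theta H.carrier) ≠ 0 :=
  (Real.log_neg H.discretelyValued.theta_pos H.discretelyValued.theta_lt_one).ne

lemma ramificationIndex_eq_div :
    (f.ramificationIndex : ℝ) = Real.log (theta H.carrier) / Real.log (theta H'.carrier) := by
  rw [f.theta_eq_pow, Real.log_pow, mul_div_cancel_right₀ _ (log_theta_ne_zero H')]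

lemma map_mem_integers (x : integers H.carrier) : f.toFun x ∈ integers H'.carrier :=
  mem_integers.2 ((f.val_map _).trans_le (mem_integers.1 x.2))

lemma exists_map_eq_mul_pow (x : maxIdeal H.carrier) {ϖ : H'.carrier} (hϖ : IsUniformizer ϖ) :
    ∃ a : integers H'.carrier, f.toFun x = a * ϖ ^ f.ramificationIndex := by
  have hv : val (ϖ ^ f.ramificationIndex) = theta H.carrier := by
    rw [val_pow, f.theta_eq_pow, show val ϖ = _ from hϖ]
  obtain ⟨a, ha, hva⟩ := exists_eq_mul (f.toFun x) (y := ϖ ^ f.ramificationIndex)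
    (ne_zero_of_val_pos (by rw [hv]; exact H.discretelyValued.theta_pos))
  refine ⟨⟨a, mem_integers.2 ?_⟩, ha⟩
  rw [hva, hv, f.val_map]
  exact div_le_one_of_le₀ (mem_maxIdeal.1 x.2) H.discretelyValued.theta_pos.le

lemma val_eq_one_of_map_eq {x : H.carrier} (hx : IsUniformizer x) {ϖ a : H'.carrier}
    (hϖ : IsUniformizer ϖ) (h : f.toFun x = a * ϖ ^ f.ramificationIndex) : val a = 1 := by
  have h1 := congrArg val h
  rw [f.val_map, val_mul, val_pow, show val ϖ = _ from hϖ, ← f.theta_eq_pow,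
    show val x = _ from hx] at h1
  exact (mul_eq_right₀ H.discretelyValued.theta_pos.ne').1 h1.symm

end ValuedHyperfieldHom

namespace TripleReduction

variable {H : DVHyp.{u}} {T : Triple.{u}} (p : TripleReduction H.carrier T)

lemma isUnit_redR {a : integers H.carrier} (ha : val (a : H.carrier) = 1) :
    IsUnit (p.redR a) := by
  obtain ⟨y, hy, hv⟩ := exists_val_eq_inv (ne_zero_of_val_pos (x := (a : H.carrier))
    (by rw [ha]; exact one_pos))
  rw [ha, inv_one] at hv
  refine IsUnit.of_mul_eq_one (p.redR ⟨y, mem_integers.2 hv.le⟩) ?_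
  rw [← p.redR_mul a ⟨y, mem_integers.2 hv.le⟩ ⟨1, mem_integers.2 hyp_val_one.le⟩ hy.symm,
    p.redR_one _ rfl]

/-- Since `|ϖ| = θ_H`, congruence of `a ϖ` and `b ϖ` modulo `θ_H ρ_H` is congruence of `a` and `b`
modulo `ρ_H`. Only the reduction data enter, so the statement holds for every model of the triple.
-/
lemma redM_uniformizer_generator {ϖ : maxIdeal H.carrier} (hϖ : IsUniformizer (ϖ : H.carrier)) :
    Function.Bijective fun c : T.R => c • p.redM ϖ := by
  have hθ := H.discretelyValued.theta_pos
  have hmem : ∀ a : integers H.carrier, (a : H.carrier) * ϖ ∈ maxIdeal H.carrier := fun a =>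
    mem_maxIdeal.2 (by
      rw [val_mul, show val (ϖ : H.carrier) = _ from hϖ]
      exact mul_le_of_le_one_left hθ.le (mem_integers.1 a.2))
  constructor
  · intro c d h
    obtain ⟨a, rfl⟩ := p.redR_surjective c
    obtain ⟨b, rfl⟩ := p.redR_surjective d
    simp only [← p.redM_smul a ϖ ⟨_, hmem a⟩ rfl, ← p.redM_smul b ϖ ⟨_, hmem b⟩ rfl] at h
    rw [p.redM_eq_iff, congrMod, hyperDist_mul_right, show val (ϖ : H.carrier) = _ from hϖ,
      mul_comm (theta _), mul_le_mul_iff_of_pos_right hθ] at h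
    exact (p.redR_eq_iff _ _).2 h
  · intro m
    obtain ⟨x, rfl⟩ := p.redM_surjective m
    obtain ⟨a, ha, hv⟩ := exists_eq_mul (x : H.carrier)
      (H.discretelyValued.uniformizer_ne_zero hϖ)
    have ha1 : a ∈ integers H.carrier := mem_integers.2 (by
      rw [hv, show val (ϖ : H.carrier) = _ from hϖ]
      exact div_le_one_of_le₀ (mem_maxIdeal.1 x.2) hθ.le)
    exact ⟨p.redR ⟨a, ha1⟩, (p.redM_smul ⟨a, ha1⟩ ϖ x ha).symm⟩

/-- Powers of `redM ϖ` generate the tensor powers. -/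
lemma smul_ι_pow_injective {ϖ : maxIdeal H.carrier} (hϖ : IsUniformizer (ϖ : H.carrier)) (n : ℕ)
    {c d : T.R} (h : c • TensorAlgebra.ι T.R (p.redM ϖ) ^ n =
      d • TensorAlgebra.ι T.R (p.redM ϖ) ^ n) : c = d :=
  (tensorPow_generator (p.redM_uniformizer_generator hϖ) n
    ⟨_, Submodule.pow_mem_pow _ (LinearMap.mem_range_self _ (p.redM ϖ)) n⟩ rfl).1 (Subtype.ext h)

lemma redR_pow {a b : integers H.carrier} {n : ℕ} (h : (b : H.carrier) = (a : H.carrier) ^ n) :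
    p.redR b = p.redR a ^ n := by
  induction n generalizing b with
  | zero => rw [pow_zero] at h ⊢; exact p.redR_one _ h
  | succ n ih =>
    have hm : (a : H.carrier) ^ n ∈ integers H.carrier := mem_integers.2 (by
      rw [val_pow]; exact pow_le_one₀ (val_nonneg _) (mem_integers.1 a.2))
    rw [pow_succ, ← ih (b := ⟨_, hm⟩) rfl]
    exact p.redR_mul _ _ _ (by rw [h, pow_succ])

lemma exists_uniformizer_mem (H : DVHyp.{u}) :
    ∃ ϖ : maxIdeal H.carrier, IsUniformizer (ϖ : H.carrier) :=
  ⟨⟨H.uniformizer, mem_maxIdeal.2 H.val_uniformizer.le⟩, H.val_uniformizer⟩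

end TripleReduction

/-! ### Morphisms of triples induced by homomorphisms -/

section Induced

variable {H H' H'' : DVHyp.{u}} {T T' T'' : Triple.{u}}
  {p : TripleReduction H.carrier T} {p' : TripleReduction H'.carrier T'}
  {p'' : TripleReduction H''.carrier T''}
  {f g : ValuedHyperfieldHom H.carrier H'.carrier}
  {k : ValuedHyperfieldHom H'.carrier H''.carrier} {F G : Triple.Hom T T'}
  {K : Triple.Hom T' T''}

open ValuedHyperfieldHom

lemma IsInducedBy.r_eq (h : IsInducedBy p p' f F) : F.r = f.ramificationIndex := by
  have := h.1
  rw [← f.ramificationIndex_eq_div] at this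
  exact_mod_cast this

/-- A homomorphism induces at most one morphism. -/
lemma IsInducedBy.unique (hF : IsInducedBy p p' f F) (hG : IsInducedBy p p' f G) : F = G := by
  apply Triple.Hom.ext'
  · rw [hF.r_eq, hG.r_eq]
  · ext c
    obtain ⟨x, rfl⟩ := p.redR_surjective c
    rw [hF.2.1 x ⟨_, f.map_mem_integers x⟩ rfl, hG.2.1 x ⟨_, f.map_mem_integers x⟩ rfl]
  · intro m
    obtain ⟨x, rfl⟩ := p.redM_surjective m
    -- The condition on `η` is imposed for all uniformizers, but one of them already determines `η`.
    obtain ⟨ϖ, hϖ⟩ := TripleReduction.exists_uniformizer_mem H'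
    obtain ⟨a, ha⟩ := f.exists_map_eq_mul_pow x hϖ
    rw [hF.2.2 x ϖ a hϖ (by rw [hF.r_eq, ha]), hG.2.2 x ϖ a hϖ (by rw [hG.r_eq, ha]), hF.r_eq,
      hG.r_eq]

lemma isInducedBy_id : IsInducedBy p p (ValuedHyperfieldHom.id H.carrier) (Triple.Hom.id T) := by
  refine ⟨?_, fun x y hxy => ?_, fun x ϖ a hϖ h => ?_⟩
  · rw [div_self (log_theta_ne_zero H)]
    exact Nat.cast_one
  · obtain rfl : y = x := Subtype.ext hxy
    rfl
  · change (x : H.carrier) = a * (ϖ : H.carrier) ^ 1 at h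
    rw [pow_one] at h
    rw [Triple.Hom.id_η_coe, p.redM_smul a ϖ x h, map_smul]
    change _ = _ • _ ^ 1
    rw [pow_one]

/-- With `f x = b ϖ' ^ r` and `k ϖ' = c ϖ ^ s`, the coefficient of `k (f x)` at `ϖ ^ (s r)` is `k(b)
c ^ r`. This is also the coefficient produced by the `r`-th tensor power of the second `η`. -/
lemma IsInducedBy.comp (hF : IsInducedBy p p' f F) (hK : IsInducedBy p' p'' k K) :
    IsInducedBy p p'' (ValuedHyperfieldHom.comp f k) (Triple.Hom.comp F K) := by
  obtain ⟨ϖ', hϖ'⟩ := TripleReduction.exists_uniformizer_mem H'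
  refine ⟨?_, fun x y hxy => ?_, fun x ϖ a hϖ h => ?_⟩
  · change ((K.r * F.r : ℕ) : ℝ) = _
    have := log_theta_ne_zero H'
    have := log_theta_ne_zero H''
    rw [Nat.cast_mul, hF.1, hK.1]
    field_simp
  · change K.φ (F.φ _) = _
    rw [hF.2.1 x ⟨_, f.map_mem_integers x⟩ rfl]
    exact hK.2.1 _ _ hxy
  · change k.toFun (f.toFun x) = a * (ϖ : H''.carrier) ^ (K.r * F.r) at h
    change _ = _ • _ ^ (K.r * F.r)
    obtain ⟨b, hb⟩ := f.exists_map_eq_mul_pow x hϖ'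
    obtain ⟨c, hc⟩ := k.exists_map_eq_mul_pow ϖ' hϖ
    rw [← hF.r_eq] at hb
    rw [← hK.r_eq] at hc
    have hmap : ∀ n : ℕ, k.toFun ((ϖ' : H'.carrier) ^ n) = k.toFun ϖ' ^ n := by
      intro n
      induction n with
      | zero => rw [pow_zero, pow_zero, k.map_one']
      | succ n ih => rw [pow_succ, k.map_mul, ih, pow_succ]
    rw [hb, k.map_mul, hmap, hc, mul_pow, ← pow_mul, ← mul_assoc] at h
    -- The coefficient `a` is prescribed from outside; cancelling the power of `ϖ` identifies it
    -- with `k(b) c ^ r`.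
    have ha := mul_right_cancel_of_ne_zero (ne_zero_of_val_pos (by
      rw [val_pow, show val (ϖ : H''.carrier) = _ from hϖ]
      exact pow_pos H''.discretelyValued.theta_pos _)) h
    have hcn : (c : H''.carrier) ^ F.r ∈ integers H''.carrier := mem_integers.2 (by
      rw [val_pow]; exact pow_le_one₀ (val_nonneg _) (mem_integers.1 c.2))
    rw [Triple.Hom.comp_η_coe, hF.2.2 x ϖ' b hϖ' hb, Triple.Hom.tensorMap, semiLift_smul, map_pow]
    change K.φ _ • (K.tensorMap _) ^ F.r = _
    rw [Triple.Hom.tensorMap_ι, hK.2.2 ϖ' ϖ c hϖ hc, smul_pow, ← pow_mul, smul_smul,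
      hK.2.1 b ⟨_, k.map_mem_integers b⟩ rfl,
      p''.redR_mul ⟨_, k.map_mem_integers b⟩ ⟨_, hcn⟩ a ha.symm,
      p''.redR_pow (a := c) (b := ⟨_, hcn⟩) rfl]

/-- A homomorphism is determined by the morphism which it induces. -/
lemma IsInducedBy.eq_of_eq (hf : IsInducedBy p p' f F) (hg : IsInducedBy p p' g F) : f = g := by
  obtain ⟨ϖ', hϖ'⟩ := TripleReduction.exists_uniformizer_mem H'
  have hd := H.discretelyValued
  have hd' := H'.discretelyValued
  -- A unit is alone in its class, by `eq_of_hyperDist_le` at value `1`.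
  have eq_of_redR : ∀ a b : integers H'.carrier, val (a : H'.carrier) = 1 →
      p'.redR a = p'.redR b → (a : H'.carrier) = b := by
    intro a b ha h
    rw [p'.redR_eq_iff] at h
    exact hd'.eq_of_hyperDist_le (by rw [ha, mul_one]; exact h)
  have hunit : ∀ x : H.carrier, val x = 1 → f.toFun x = g.toFun x := by
    intro x hx
    let x' : integers H.carrier := ⟨x, mem_integers.2 hx.le⟩
    refine eq_of_redR ⟨_, f.map_mem_integers x'⟩ ⟨_, g.map_mem_integers x'⟩
      ((f.val_map _).trans hx) ?_
    rw [← hf.2.1 x' _ rfl, ← hg.2.1 x' _ rfl]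
  -- On uniformizers `φ` is too coarse. The map `η` gives the class of the coefficient of `ϖ' ^ r`,
  -- which is a unit and hence known exactly.
  have hunif : ∀ x : H.carrier, IsUniformizer x → f.toFun x = g.toFun x := by
    intro x hx
    let x' : maxIdeal H.carrier := ⟨x, mem_maxIdeal.2 hx.le⟩
    obtain ⟨a, ha⟩ := f.exists_map_eq_mul_pow x' hϖ'
    obtain ⟨b, hb⟩ := g.exists_map_eq_mul_pow x' hϖ'
    have ha1 := f.val_eq_one_of_map_eq hx hϖ' ha
    rw [← hf.r_eq] at ha
    rw [← hg.r_eq] at hb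
    have h := hf.2.2 x' ϖ' a hϖ' ha
    rw [hg.2.2 x' ϖ' b hϖ' hb] at h
    change f.toFun x = _ at ha
    change g.toFun x = _ at hb
    rw [ha, hb, eq_of_redR a b ha1 (p'.smul_ι_pow_injective hϖ' _ h).symm]
  -- every nonzero element is a product of a unit and a power of a uniformizer
  have hϖ := H.val_uniformizer
  have hϖ0 := hd.uniformizer_ne_zero hϖ
  -- Both signs of the exponent are treated in one induction: divide by the uniformizer for positive
  -- exponents, multiply by it and cancel for negative ones.
  have hpow : ∀ (n : ℕ) (x : H.carrier), (val x = theta H.carrier ^ n ∨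
      val x = (theta H.carrier ^ n)⁻¹) → f.toFun x = g.toFun x := by
    intro n
    have hθ := hd.theta_pos
    induction n with
    | zero => exact fun x hx => hunit x (by simpa using hx)
    | succ n ih =>
      intro x hx
      rcases hx with hx | hx
      · obtain ⟨a, rfl, hv⟩ := exists_eq_mul x hϖ0
        rw [f.map_mul, g.map_mul, hunif _ hϖ, ih a (Or.inl ?_)]
        rw [hv, hx, hϖ, pow_succ]
        field_simp
      · have h : f.toFun (x * H.uniformizer) = g.toFun (x * H.uniformizer) := by
          refine ih _ (Or.inr ?_)
          rw [val_mul, hx, hϖ, pow_succ]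
          field_simp
        rw [f.map_mul, g.map_mul, hunif _ hϖ] at h
        refine mul_right_cancel_of_ne_zero (ne_zero_of_val_pos ?_) h
        rw [g.val_map]
        exact val_pos hϖ0
  apply ValuedHyperfieldHom.ext
  intro x
  by_cases hx : x = 0
  · rw [hx, f.map_zero', g.map_zero']
  obtain ⟨n, hn⟩ := hd.exists_zpow_eq_val hx
  obtain ⟨m, rfl | rfl⟩ := n.eq_nat_or_neg
  · exact hpow m x (Or.inl (by rw [hn, zpow_natCast]))
  · exact hpow m x (Or.inr (by rw [hn, zpow_neg, zpow_natCast]))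

variable (p p' f)

/-- Distances do not grow under `f` and `ρ_H ≤ ρ_{H'}`, so congruent integers have congruent images.
The ring laws are then checked on representatives. -/
lemma exists_induced_ringHom : ∃ φ : T.R →+* T'.R,
    ∀ (x : integers H.carrier) (y : integers H'.carrier), (y : H'.carrier) = f.toFun x →
      φ (p.redR x) = p'.redR y := by
  choose s hs using p.redR_surjective
  let φ : T.R → T'.R := fun c => p'.redR ⟨_, f.map_mem_integers (s c)⟩
  have hφ : ∀ (x : integers H.carrier) (y : integers H'.carrier), (y : H'.carrier) = f.toFun x →
      φ (p.redR x) = p'.redR y := by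
    intro x y hxy
    refine (p'.redR_eq_iff _ _).2 ?_
    rw [congrMod, hxy]
    exact (f.hyperDist_map_le _ _).trans (((p.redR_eq_iff _ _).1 (hs _)).trans f.krasnerNorm_le)
  have hmul : ∀ c d, φ (c * d) = φ c * φ d := by
    intro c d
    obtain ⟨x, rfl⟩ := p.redR_surjective c
    obtain ⟨y, rfl⟩ := p.redR_surjective d
    rw [← p.redR_mul x y (DVHyp.ResidueRing.mulInt x y) rfl, hφ x ⟨_, f.map_mem_integers x⟩ rfl,
      hφ y ⟨_, f.map_mem_integers y⟩ rfl,
      hφ (DVHyp.ResidueRing.mulInt x y) ⟨_, f.map_mem_integers _⟩ rfl]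
    exact p'.redR_mul _ _ _ (f.map_mul _ _)
  have hadd' : ∀ c d, φ (c + d) = φ c + φ d := by
    intro c d
    obtain ⟨x, rfl⟩ := p.redR_surjective c
    obtain ⟨y, rfl⟩ := p.redR_surjective d
    obtain ⟨z, hz⟩ := DVHyp.ResidueRing.exists_mem_hadd x y
    rw [← p.redR_add x y z hz, hφ x ⟨_, f.map_mem_integers x⟩ rfl,
      hφ y ⟨_, f.map_mem_integers y⟩ rfl, hφ z ⟨_, f.map_mem_integers _⟩ rfl]
    exact p'.redR_add _ _ _ (f.map_mem_hadd hz)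
  have hone : φ 1 = 1 := by
    have h1 : (1 : H.carrier) ∈ integers H.carrier := mem_integers.2 hyp_val_one.le
    rw [← p.redR_one ⟨1, h1⟩ rfl, hφ ⟨1, h1⟩ ⟨_, f.map_mem_integers ⟨1, h1⟩⟩ rfl]
    exact p'.redR_one _ f.map_one'
  exact ⟨{ (AddMonoidHom.mk' φ hadd' : T.R →+ T'.R) with
    map_one' := hone, map_mul' := hmul }, hφ⟩

/-- This constructs the coordinate of `η` with respect to the generator `[ϖ]^{⊗ r}`. It is well
defined because `|ϖ ^ r| = θ_H`, so removing this factor turns the radius `θ_H ρ_H` into `ρ_H ≤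
ρ_{H'}`. -/
lemma exists_induced_coeff (φ : T.R →+* T'.R) (hφ : ∀ (x : integers H.carrier)
    (y : integers H'.carrier), (y : H'.carrier) = f.toFun x → φ (p.redR x) = p'.redR y)
    {ϖ : H'.carrier} (hϖ : IsUniformizer ϖ) : ∃ η : T.M →ₛₗ[φ] T'.R,
    ∀ (x : maxIdeal H.carrier) (a : integers H'.carrier),
      f.toFun x = a * ϖ ^ f.ramificationIndex → η (p.redM x) = p'.redR a := by
  have hθ := H.discretelyValued.theta_pos
  have hv : val (ϖ ^ f.ramificationIndex) = theta H.carrier := by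
    rw [val_pow, f.theta_eq_pow, show val ϖ = _ from hϖ]
  have h0 : ϖ ^ f.ramificationIndex ≠ 0 := ne_zero_of_val_pos (by rw [hv]; exact hθ)
  choose s hs using p.redM_surjective
  choose c hc using fun x : maxIdeal H.carrier => f.exists_map_eq_mul_pow x hϖ
  let η : T.M → T'.R := fun m => p'.redR (c (s m))
  have hη : ∀ (x : maxIdeal H.carrier) (a : integers H'.carrier),
      f.toFun x = a * ϖ ^ f.ramificationIndex → η (p.redM x) = p'.redR a := by
    intro x a hxa
    refine (p'.redR_eq_iff _ _).2 ?_
    have h1 := (p.redM_eq_iff _ _).1 (hs (p.redM x))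
    have h2 := (f.hyperDist_map_le _ _).trans h1
    rw [hc, hxa, hyperDist_mul_right, hv, mul_comm, mul_le_mul_iff_of_pos_left hθ] at h2
    exact h2.trans f.krasnerNorm_le
  refine ⟨{ toFun := η, map_add' := fun m n => ?_, map_smul' := fun b m => ?_ }, hη⟩
  · obtain ⟨x, rfl⟩ := p.redM_surjective m
    obtain ⟨y, rfl⟩ := p.redM_surjective n
    obtain ⟨z, hz⟩ := hyp_hadd_nonempty (x : H.carrier) y
    lift z to maxIdeal H.carrier using mem_maxIdeal.2 ((val_le_max _ _ _ hz).trans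
      (max_le (mem_maxIdeal.1 x.2) (mem_maxIdeal.1 y.2)))
    rw [← p.redM_add x y z hz, hη x _ (hc x), hη y _ (hc y), hη z _ (hc z)]
    have h := f.map_mem_hadd hz
    rw [hc x, hc y, hc z, mul_mem_hadd_iff h0] at h
    exact p'.redR_add _ _ _ h
  · obtain ⟨x, rfl⟩ := p.redM_surjective m
    obtain ⟨a, rfl⟩ := p.redR_surjective b
    have hm : (a : H.carrier) * x ∈ maxIdeal H.carrier := mem_maxIdeal.2 (by
      rw [val_mul]
      exact (mul_le_of_le_one_left (val_nonneg _) (mem_integers.1 a.2)).trans (mem_maxIdeal.1 x.2))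
    rw [← p.redM_smul a x ⟨_, hm⟩ rfl, hη x _ (hc x), hη ⟨_, hm⟩ _ (hc ⟨_, hm⟩),
      hφ a ⟨_, f.map_mem_integers a⟩ rfl, smul_eq_mul]
    refine p'.redR_mul _ _ _ (mul_right_cancel_of_ne_zero h0 ?_)
    rw [← hc ⟨_, hm⟩, f.map_mul, mul_assoc, ← hc x]

lemma exists_isInducedBy : ∃ F : Triple.Hom T T', IsInducedBy p p' f F := by
  obtain ⟨ϖ, hϖ⟩ := TripleReduction.exists_uniformizer_mem H'
  obtain ⟨π, hπ⟩ := TripleReduction.exists_uniformizer_mem H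
  obtain ⟨φ, hφ⟩ := exists_induced_ringHom p p' f
  obtain ⟨η, hη⟩ := exists_induced_coeff p p' f φ hφ hϖ
  set r := f.ramificationIndex
  let g : tensorPow T'.R T'.M r := ⟨TensorAlgebra.ι T'.R (p'.redM ϖ) ^ r,
    Submodule.pow_mem_pow _ (LinearMap.mem_range_self _ (p'.redM ϖ)) r⟩
  let η' : T.M →ₛₗ[φ] tensorPow T'.R T'.M r := (LinearMap.toSpanSingleton _ _ g).comp η
  have hη' : ∀ m, η' m = η m • g := fun m => rfl
  refine ⟨⟨r, f.ramificationIndex_pos, φ, η', fun m => ?_, ?_⟩, f.ramificationIndex_eq_div, hφ,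
    fun x ϖ' b hϖ' h => ?_⟩
  · obtain ⟨x, rfl⟩ := p.redM_surjective m
    obtain ⟨a, ha⟩ := f.exists_map_eq_mul_pow x hϖ
    have hx : (x : H.carrier) ∈ integers H.carrier := mem_integers.2
      ((mem_maxIdeal.1 x.2).trans H.discretelyValued.theta_lt_one.le)
    have hϖ1 : (ϖ : H'.carrier) ∈ integers H'.carrier := mem_integers.2
      ((mem_maxIdeal.1 ϖ.2).trans H'.discretelyValued.theta_lt_one.le)
    have hϖr : (ϖ : H'.carrier) ^ r ∈ integers H'.carrier := mem_integers.2 (by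
      rw [val_pow]; exact pow_le_one₀ (val_nonneg _) (mem_integers.1 hϖ1))
    have hg : T'.εPow r g = p'.redR ⟨_, hϖr⟩ := by
      rw [p'.redR_pow (a := ⟨_, hϖ1⟩) rfl, ← p'.ε_redM ϖ ⟨_, hϖ1⟩ rfl]
      simp [Triple.εPow, g]
    rw [p.ε_redM x ⟨_, hx⟩ rfl, hφ ⟨_, hx⟩ ⟨_, f.map_mem_integers ⟨_, hx⟩⟩ rfl, hη', hη x a ha,
      map_smul, hg, smul_eq_mul]
    exact p'.redR_mul _ _ _ ha
  -- The generator `[π]` goes to a unit multiple of the generator `[ϖ]^{⊗ r}`.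
  · rw [inducesIso_iff (p.redM_uniformizer_generator hπ)]
    obtain ⟨a, ha⟩ := f.exists_map_eq_mul_pow π hϖ
    exact bijective_of_isUnit_smul_eq
      (tensorPow_generator (p'.redM_uniformizer_generator hϖ) r g rfl)
      (p'.isUnit_redR (f.val_eq_one_of_map_eq hπ hϖ ha)) (by rw [hη', hη π a ha])
  · change f.toFun x = b * (ϖ' : H'.carrier) ^ r at h
    change η (p.redM x) • TensorAlgebra.ι T'.R (p'.redM ϖ) ^ r =
      p'.redR b • TensorAlgebra.ι T'.R (p'.redM ϖ') ^ r
    -- The construction used one uniformizer `ϖ`. For another one, `ϖ' = v ϖ`, the factor `v ^ r`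
    -- moves between the coefficient and the tensor power.
    obtain ⟨v, hv, hvv⟩ := exists_eq_mul (ϖ' : H'.carrier)
      (H'.discretelyValued.uniformizer_ne_zero hϖ)
    have hv1 : v ∈ integers H'.carrier := mem_integers.2 (by
      rw [hvv, show val (ϖ : H'.carrier) = _ from hϖ, show val (ϖ' : H'.carrier) = _ from hϖ',
        div_self H'.discretelyValued.theta_pos.ne'])
    have hvr : v ^ r ∈ integers H'.carrier := mem_integers.2 (by
      rw [val_pow]; exact pow_le_one₀ (val_nonneg _) (mem_integers.1 hv1))
    rw [hv, mul_pow, ← mul_assoc] at h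
    rw [hη x (DVHyp.ResidueRing.mulInt b ⟨_, hvr⟩) h, p'.redR_mul b ⟨_, hvr⟩ _ rfl,
      p'.redM_smul ⟨v, hv1⟩ ϖ ϖ' hv, map_smul, smul_pow, smul_smul,
      p'.redR_pow (a := ⟨v, hv1⟩) (b := ⟨_, hvr⟩) rfl]

/-- The morphism of triples induced by a homomorphism. -/
noncomputable def inducedHom : Triple.Hom T T' := (exists_isInducedBy p p' f).choose

lemma isInducedBy_inducedHom : IsInducedBy p p' f (inducedHom p p' f) :=
  (exists_isInducedBy p p' f).choose_spec

end Induced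

/-- Two triples of the same hyperfield are isomorphic. -/
noncomputable def TripleReduction.iso {H : DVHyp.{u}} {T T' : Triple.{u}}
    (p : TripleReduction H.carrier T) (p' : TripleReduction H.carrier T') : T ≅ T' where
  hom := inducedHom p p' (ValuedHyperfieldHom.id H.carrier)
  inv := inducedHom p' p (ValuedHyperfieldHom.id H.carrier)
  -- The composite of two identity homomorphisms unfolds to the identity, so both morphisms are
  -- induced by the same homomorphism.
  hom_inv_id := ((isInducedBy_inducedHom _ _ _).comp (isInducedBy_inducedHom _ _ _)).unique
    isInducedBy_id
  inv_hom_id := ((isInducedBy_inducedHom _ _ _).comp (isInducedBy_inducedHom _ _ _)).unique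
    isInducedBy_id

/-- The functor from discretely valued hyperfields which are not fields to triples. -/
noncomputable def DVHyp.tripleFunctor : DVHyp.{u} ⥤ Triple.{u} where
  obj H := H.triple
  map {H H'} f := inducedHom H.tripleReduction H'.tripleReduction f
  map_id _ := (isInducedBy_inducedHom _ _ _).unique isInducedBy_id
  map_comp _ _ := (isInducedBy_inducedHom _ _ _).unique
    ((isInducedBy_inducedHom _ _ _).comp (isInducedBy_inducedHom _ _ _))

/-! ### The hyperfield of a triple -/

/-- A generator `t` of the maximal ideal of a truncated discrete valuation ring, and its
nilpotency order. -/
structure TruncatedUniformizer (R : Type u) [CommRing R] [IsLocalRing R] where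
  t : R
  maximalIdeal_eq : IsLocalRing.maximalIdeal R = Ideal.span {t}
  length : ℕ
  pow_eq_zero_iff : ∀ n : ℕ, t ^ n = 0 ↔ length ≤ n

/-- The elements `u π ^ n` with `u` a unit of the truncated discrete valuation ring `R` and `n` an
integer, together with zero. -/
inductive TruncatedField {R : Type u} [CommRing R] [IsLocalRing R] (D : TruncatedUniformizer R) :
    Type u
  | zero : TruncatedField D
  | monomial (u : Rˣ) (n : ℤ) : TruncatedField D

section TruncatedField

variable {R : Type u} [CommRing R] [IsLocalRing R]

namespace TruncatedUniformizer

variable (D : TruncatedUniformizer R)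

lemma t_mul_mem_nonunits (a : R) : D.t * a ∈ nonunits R := by
  rw [← IsLocalRing.mem_maximalIdeal, D.maximalIdeal_eq]
  exact Ideal.mem_span_singleton.2 (dvd_mul_right _ _)

/-- Take the last power of `t` dividing `s`; it exists because `t` is nilpotent. The cofactor is not
divisible by `t`, so it lies outside the maximal ideal. -/
lemma exists_eq_unit_mul_pow {s : R} (hs : s ≠ 0) : ∃ (v : Rˣ) (n : ℕ), s = v * D.t ^ n := by
  classical
  have hex : ∃ n, ¬ D.t ^ n ∣ s :=
    ⟨D.length, fun h => hs (by rwa [(D.pow_eq_zero_iff _).2 le_rfl, zero_dvd_iff] at h)⟩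
  have h0 : Nat.find hex ≠ 0 := fun h => Nat.find_spec hex (by rw [h, pow_zero]; exact one_dvd _)
  obtain ⟨n, hn⟩ := Nat.exists_eq_succ_of_ne_zero h0
  obtain ⟨c, hc⟩ := not_not.1 (Nat.find_min hex (m := n) (by omega))
  have hcu : IsUnit c := by
    by_contra hcu
    rw [← mem_nonunits_iff, ← IsLocalRing.mem_maximalIdeal, D.maximalIdeal_eq,
      Ideal.mem_span_singleton] at hcu
    obtain ⟨d, rfl⟩ := hcu
    refine Nat.find_spec hex ?_
    rw [hn, hc, ← mul_assoc, ← pow_succ]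
    exact dvd_mul_right _ _
  exact ⟨hcu.unit, n, by rw [hc, mul_comm]; rfl⟩

end TruncatedUniformizer

namespace TruncatedField

variable {D : TruncatedUniformizer R}

instance : Zero (TruncatedField D) := ⟨zero⟩

instance : Neg (TruncatedField D) :=
  ⟨fun x => match x with
    | zero => zero
    | monomial u n => monomial (-u) n⟩

instance : Mul (TruncatedField D) :=
  ⟨fun x y => match x, y with
    | monomial u m, monomial v n => monomial (u * v) (m + n)
    | _, _ => zero⟩

instance : One (TruncatedField D) := ⟨monomial 1 0⟩

lemma one_def : (1 : TruncatedField D) = monomial 1 0 := rfl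

lemma monomial_ne_zero (u : Rˣ) (n : ℤ) : (monomial u n : TruncatedField D) ≠ 0 := nofun

lemma monomial_mul_monomial (u v : Rˣ) (m n : ℤ) :
    (monomial u m * monomial v n : TruncatedField D) = monomial (u * v) (m + n) := rfl

lemma mul_zero_eq (x : TruncatedField D) : x * 0 = 0 := by cases x <;> rfl

instance : CommMonoid (TruncatedField D) where
  mul_assoc x y z := by
    cases x <;> cases y <;> cases z <;> first | rfl | skip
    simp only [monomial_mul_monomial, mul_assoc, add_assoc]
  one_mul x := by
    cases x
    · rfl
    · simp only [one_def, monomial_mul_monomial, one_mul, zero_add]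
  mul_one x := by
    cases x
    · rfl
    · simp only [one_def, monomial_mul_monomial, mul_one, add_zero]
  mul_comm x y := by
    cases x <;> cases y <;> first | rfl | skip
    simp only [monomial_mul_monomial, mul_comm, add_comm]

/-- The elements of level `i` are zero and the `u π ^ n` with `i ≤ n`. -/
def IsLevel (i : ℤ) : TruncatedField D → Prop
  | zero => True
  | monomial _ n => i ≤ n

/-- The reduction in `R` of `x π ^ (-i)`, for `x` of level `i`. -/
def red (i : ℤ) : TruncatedField D → R
  | zero => 0
  | monomial u n => u * D.t ^ (n - i).toNat

lemma isLevel_zero (i : ℤ) : IsLevel i (0 : TruncatedField D) := trivial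

lemma red_zero (i : ℤ) : red i (0 : TruncatedField D) = 0 := rfl

lemma isLevel_monomial {i n : ℤ} {u : Rˣ} :
    IsLevel i (monomial u n : TruncatedField D) ↔ i ≤ n := Iff.rfl

lemma red_monomial (i n : ℤ) (u : Rˣ) :
    red i (monomial u n : TruncatedField D) = u * D.t ^ (n - i).toNat := rfl

lemma red_monomial_self (n : ℤ) (u : Rˣ) : red n (monomial u n : TruncatedField D) = u := by
  rw [red_monomial, sub_self, Int.toNat_zero, pow_zero, mul_one]

lemma IsLevel.mono {i j : ℤ} {x : TruncatedField D} (h : IsLevel i x) (hj : j ≤ i) :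
    IsLevel j x := by
  cases x
  · trivial
  · exact hj.trans h

/-- Lowering the level multiplies by a power of `t`, so reductions at high levels determine those at
lower ones. -/
lemma IsLevel.red_eq {i j : ℤ} {x : TruncatedField D} (h : IsLevel i x) (hj : j ≤ i) :
    red j x = D.t ^ (i - j).toNat * red i x := by
  cases x with
  | zero => exact (mul_zero _).symm
  | monomial u n =>
    rw [isLevel_monomial] at h
    rw [red_monomial, red_monomial, mul_left_comm, ← pow_add]
    congr 2
    omega

lemma IsLevel.red_mem_nonunits {i j : ℤ} {x : TruncatedField D} (h : IsLevel i x) (hj : j < i) :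
    red j x ∈ nonunits R := by
  rw [(h.mono (show j + 1 ≤ i from hj)).red_eq (by omega), add_sub_cancel_left, Int.toNat_one,
    pow_one]
  exact D.t_mul_mem_nonunits _

/-- Nilpotency of `t` of exact order `length` translates smallness of an element into vanishing of
its reduction. -/
lemma IsLevel.red_eq_zero_iff {i : ℤ} {x : TruncatedField D} (h : IsLevel i x) :
    red i x = 0 ↔ IsLevel (i + D.length) x := by
  cases x with
  | zero => exact ⟨fun _ => trivial, fun _ => rfl⟩
  | monomial u n =>
    rw [isLevel_monomial] at *
    rw [red_monomial, Units.mul_right_eq_zero, D.pow_eq_zero_iff]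
    omega

lemma exists_red_eq (i : ℤ) (s : R) : ∃ x : TruncatedField D, IsLevel i x ∧ red i x = s := by
  by_cases hs : s = 0
  · exact ⟨0, isLevel_zero i, hs ▸ red_zero i⟩
  · obtain ⟨v, n, rfl⟩ := D.exists_eq_unit_mul_pow hs
    exact ⟨monomial v (i + n), isLevel_monomial.2 (by omega), by
      rw [red_monomial, add_sub_cancel_left, Int.toNat_natCast]⟩

lemma isLevel_neg {i : ℤ} {x : TruncatedField D} : IsLevel i (-x) ↔ IsLevel i x := by
  cases x <;> exact Iff.rfl

lemma red_neg (i : ℤ) (x : TruncatedField D) : red i (-x) = -red i x := by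
  cases x
  · exact neg_zero.symm
  · exact (congrArg (· * _) (Units.val_neg _)).trans (neg_mul _ _)

lemma neg_neg_eq (x : TruncatedField D) : - -x = x := by
  cases x
  · rfl
  · exact congrArg (monomial · _) (neg_neg _)

lemma IsLevel.mul {i j : ℤ} {x y : TruncatedField D} (hx : IsLevel i x) (hy : IsLevel j y) :
    IsLevel (i + j) (x * y) ∧ red (i + j) (x * y) = red i x * red j y := by
  cases x with
  | zero => exact ⟨trivial, (zero_mul _).symm⟩
  | monomial u m =>
    cases y with
    | zero => exact ⟨trivial, (mul_zero _).symm⟩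
    | monomial v n =>
      rw [isLevel_monomial] at hx hy
      refine ⟨add_le_add hx hy, ?_⟩
      rw [monomial_mul_monomial, red_monomial, red_monomial, red_monomial, mul_mul_mul_comm,
        ← pow_add, Units.val_mul]
      congr 2
      omega

lemma IsLevel.of_mul_monomial {i : ℤ} {x : TruncatedField D} {u : Rˣ} {n : ℤ}
    (h : IsLevel i (x * monomial u n)) : IsLevel (i - n) x := by
  cases x with
  | zero => trivial
  | monomial v m =>
    rw [monomial_mul_monomial, isLevel_monomial] at h
    rw [isLevel_monomial]
    omega

/-- Elements are separated by their reductions at common levels. -/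
lemma eq_of_red_eq {x y : TruncatedField D}
    (h : ∀ i, IsLevel i x → IsLevel i y → red i x = red i y) : x = y := by
  cases x with
  | zero =>
    cases y with
    | zero => rfl
    | monomial v n =>
      have := h n trivial (isLevel_monomial.2 le_rfl)
      rw [red_monomial_self] at this
      exact absurd this.symm v.ne_zero
  | monomial u m =>
    cases y with
    | zero =>
      have := h m (isLevel_monomial.2 le_rfl) trivial
      rw [red_monomial_self] at this
      exact absurd this u.ne_zero
    | monomial v n =>
      have key : ∀ {m n : ℤ} {u v : Rˣ}, m < n →
          red m (monomial u m : TruncatedField D) ≠ red m (monomial v n : TruncatedField D) := by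
        intro m n u v hmn h
        have := IsLevel.red_mem_nonunits (isLevel_monomial.2 le_rfl :
          IsLevel n (monomial v n : TruncatedField D)) hmn
        rw [← h, red_monomial_self] at this
        exact this u.isUnit
      rcases lt_trichotomy m n with hmn | rfl | hmn
      · exact absurd (h m (isLevel_monomial.2 le_rfl) (isLevel_monomial.2 hmn.le)) (key hmn)
      · have := h m (isLevel_monomial.2 le_rfl) (isLevel_monomial.2 le_rfl)
        rw [red_monomial_self, red_monomial_self] at this
        rw [Units.ext this]
      · exact absurd (h n (isLevel_monomial.2 hmn.le) (isLevel_monomial.2 le_rfl)).symm (key hmn)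

/-- Elements with the same nonzero reduction have the same levels. -/
lemma isLevel_of_red_eq {i j : ℤ} {x y : TruncatedField D} (hx : IsLevel i x) (hy : IsLevel i y)
    (h : red i x = red i y) (h0 : red i x ≠ 0) (hj : IsLevel j y) : IsLevel j x := by
  -- A nonzero reduction at level `i` bounds the levels of `y`. So `j - length` is a level at or
  -- below `i`, where the reductions still agree, and their vanishing there detects level `j`.
  have hji : j < i + D.length := by
    by_contra! hcon
    exact h0 (h.trans (hy.red_eq_zero_iff.2 (hj.mono hcon)))
  have hle : j - D.length ≤ i := by omega
  have h1 : red (j - D.length) x = 0 := by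
    rw [hx.red_eq hle, h, ← hy.red_eq hle, (hy.mono hle).red_eq_zero_iff, sub_add_cancel]
    exact hj
  rwa [(hx.mono hle).red_eq_zero_iff, sub_add_cancel] at h1

/-! ### Multivalued addition on the truncated field. -/

/-- The multivalued sum: the elements whose reduction at all common levels of the summands is the
sum of their reductions. -/
def sum (x y : TruncatedField D) : Set (TruncatedField D) :=
  {z | ∀ i, IsLevel i x → IsLevel i y → IsLevel i z ∧ red i z = red i x + red i y}

/-- The largest common level of two elements. -/
lemma exists_max_level {x y : TruncatedField D} (h : ¬ (x = 0 ∧ y = 0)) :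
    ∃ n, IsLevel n x ∧ IsLevel n y ∧ ∀ i, IsLevel i x → IsLevel i y → i ≤ n := by
  cases x with
  | zero =>
    cases y with
    | zero => exact absurd ⟨rfl, rfl⟩ h
    | monomial v n => exact ⟨n, trivial, isLevel_monomial.2 le_rfl, fun i _ hi => hi⟩
  | monomial u m =>
    cases y with
    | zero => exact ⟨m, isLevel_monomial.2 le_rfl, trivial, fun i hi _ => hi⟩
    | monomial v n =>
      exact ⟨min m n, min_le_left _ _, min_le_right _ _, fun i hi hi' => le_min hi hi'⟩

lemma mem_sum_of_max_level {x y z : TruncatedField D} {n : ℤ} (hx : IsLevel n x)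
    (hy : IsLevel n y) (hn : ∀ i, IsLevel i x → IsLevel i y → i ≤ n) (hz : IsLevel n z)
    (h : red n z = red n x + red n y) : z ∈ sum x y := by
  intro i hix hiy
  have hi := hn i hix hiy
  exact ⟨hz.mono hi, by rw [hz.red_eq hi, hx.red_eq hi, hy.red_eq hi, h, mul_add]⟩

lemma sum_zero (x : TruncatedField D) : sum x 0 = {x} := by
  ext z
  rw [Set.mem_singleton_iff]
  constructor
  · intro h
    refine (eq_of_red_eq fun i hi _ => ?_).symm
    rw [(h i hi (isLevel_zero i)).2, red_zero, add_zero]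
  · rintro rfl
    exact fun i hi _ => ⟨hi, by rw [red_zero, add_zero]⟩

lemma sum_comm (x y : TruncatedField D) : sum x y = sum y x := by
  ext z
  exact ⟨fun h i hx hy => by rw [add_comm]; exact h i hy hx,
    fun h i hx hy => by rw [add_comm]; exact h i hy hx⟩

lemma sum_nonempty (x y : TruncatedField D) : (sum x y).Nonempty := by
  by_cases h : x = 0 ∧ y = 0
  · rw [h.1, h.2, sum_zero]
    exact Set.singleton_nonempty _
  · obtain ⟨n, hx, hy, hn⟩ := exists_max_level h
    obtain ⟨z, hz, hzr⟩ := exists_red_eq (D := D) n (red n x + red n y)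
    exact ⟨z, mem_sum_of_max_level hx hy hn hz hzr⟩

lemma zero_mem_sum_neg (x : TruncatedField D) : 0 ∈ sum x (-x) := fun i _ _ =>
  ⟨isLevel_zero i, by rw [red_zero, red_neg, add_neg_cancel]⟩

lemma eq_neg_of_zero_mem_sum {x y : TruncatedField D} (h : 0 ∈ sum x y) : y = -x := by
  refine eq_of_red_eq fun i hy hx => ?_
  rw [red_neg, eq_neg_iff_add_eq_zero, add_comm, ← (h i (isLevel_neg.1 hx) hy).2, red_zero]

lemma mem_sum_neg_of_mem_sum {x y z : TruncatedField D} (h : x ∈ sum y z) : y ∈ sum x (-z) := by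
  intro i hx hz
  rw [isLevel_neg] at hz
  have hy : IsLevel i y := by
    -- Otherwise `y` would have exact level `n < i`, and its unit reduction there would be a
    -- difference of two elements of the maximal ideal.
    by_contra hy
    cases y with
    | zero => exact hy trivial
    | monomial u n =>
      rw [isLevel_monomial, not_le] at hy
      have h1 := (h n (isLevel_monomial.2 le_rfl) (hz.mono hy.le)).2
      rw [red_monomial_self, ← sub_eq_iff_eq_add] at h1
      refine (IsLocalRing.mem_maximalIdeal (u : R)).1 ?_ u.isUnit
      rw [← h1]
      exact Ideal.sub_mem _ (hx.red_mem_nonunits hy) (hz.red_mem_nonunits hy)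
  exact ⟨hy, by rw [(h i hy hz).2, red_neg, add_neg_cancel_right]⟩

lemma mem_sum_neg_iff {x y z : TruncatedField D} : x ∈ sum y (-z) ↔ y ∈ sum x z :=
  ⟨fun h => by simpa only [neg_neg_eq] using mem_sum_neg_of_mem_sum h, mem_sum_neg_of_mem_sum⟩

/-- The right-hand side is symmetric in the three summands, which makes associativity immediate. -/
lemma mem_iUnion_sum_iff {x y z w : TruncatedField D} :
    w ∈ (⋃ s ∈ sum x y, sum s z) ↔ ∀ i, IsLevel i x → IsLevel i y → IsLevel i z →
      IsLevel i w ∧ red i w = red i x + red i y + red i z := by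
  simp only [Set.mem_iUnion, exists_prop]
  constructor
  · rintro ⟨s, hs, hw⟩ i hx hy hz
    rw [← (hs i hx hy).2]
    exact hw i (hs i hx hy).1 hz
  · intro h
    by_cases h0 : x = 0 ∧ y = 0
    · obtain ⟨rfl, rfl⟩ := h0
      refine ⟨0, by rw [sum_zero]; rfl, fun i _ hz => ?_⟩
      simpa only [red_zero, add_zero] using h i (isLevel_zero i) (isLevel_zero i) hz
    obtain ⟨n, hx, hy, hn⟩ := exists_max_level h0
    -- If `z` reaches the top common level `n` of `x` and `y`, any `s` in `w - z` works. Otherwise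
    -- all levels of `z` are below `n`, and any `s` in `x + y` works.
    by_cases hz : IsLevel n z
    · obtain ⟨s, hs⟩ := sum_nonempty w (-z)
      refine ⟨s, ?_, mem_sum_neg_iff.1 hs⟩
      obtain ⟨hwl, hwr⟩ := h n hx hy hz
      obtain ⟨hsl, hsr⟩ := hs n hwl (isLevel_neg.2 hz)
      exact mem_sum_of_max_level hx hy hn hsl (by rw [hsr, hwr, red_neg, add_neg_cancel_right])
    · obtain ⟨s, hs⟩ := sum_nonempty x y
      refine ⟨s, hs, fun i _ hzi => ?_⟩
      have hin : i ≤ n := by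
        by_contra! hlt
        exact hz (hzi.mono hlt.le)
      rw [(hs i (hx.mono hin) (hy.mono hin)).2]
      exact h i (hx.mono hin) (hy.mono hin) hzi

lemma sum_assoc (x y z : TruncatedField D) :
    (⋃ s ∈ sum x y, sum s z) = ⋃ s ∈ sum y z, sum x s := by
  ext w
  -- Commuting the outer sum on the right puts both sides into the form of `mem_iUnion_sum_iff`; the
  -- next rewrite restores the inner sum on the left.
  simp only [sum_comm x]
  rw [← sum_comm x, mem_iUnion_sum_iff, mem_iUnion_sum_iff]
  constructor
  · intro h i hy hz hx
    rw [add_comm (_ + _), ← add_assoc]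
    exact h i hx hy hz
  · intro h i hx hy hz
    rw [add_assoc, add_comm]
    exact h i hy hz hx

lemma mul_mem_sum {x y s : TruncatedField D} (z : TruncatedField D) (h : s ∈ sum x y) :
    s * z ∈ sum (x * z) (y * z) := by
  cases z with
  | zero =>
    change s * 0 ∈ sum (x * 0) (y * 0)
    rw [mul_zero_eq, mul_zero_eq, mul_zero_eq, sum_zero]
    rfl
  | monomial u n =>
    intro i hx hy
    have hu : IsLevel n (monomial u n : TruncatedField D) := isLevel_monomial.2 le_rfl
    have hx := hx.of_mul_monomial
    have hy := hy.of_mul_monomial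
    obtain ⟨hs, hsr⟩ := h _ hx hy
    have h1 := hs.mul hu
    have h2 := hx.mul hu
    have h3 := hy.mul hu
    rw [sub_add_cancel] at h1 h2 h3
    exact ⟨h1.1, by rw [h1.2, h2.2, h3.2, hsr, add_mul]⟩

instance : Hyperfield (TruncatedField D) where
  hadd := sum
  hadd_assoc := sum_assoc
  hadd_comm := sum_comm
  hadd_zero := sum_zero
  zero_mem_hadd_neg := zero_mem_sum_neg
  eq_neg_of_zero_mem _ _ := eq_neg_of_zero_mem_sum
  mem_hadd_neg_iff _ _ _ := mem_sum_neg_iff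
  hadd_mul_subset x y z := by
    rintro _ ⟨s, hs, rfl⟩
    exact mul_mem_sum z hs
  exists_mul_eq_one x hx := by
    cases x with
    | zero => exact absurd rfl hx
    | monomial u n =>
      exact ⟨monomial u⁻¹ (-n), by rw [monomial_mul_monomial, mul_inv_cancel, add_neg_cancel]; rfl⟩
  zero_ne_one := (monomial_ne_zero 1 0).symm

lemma mem_hadd {x y z : TruncatedField D} : z ∈ hadd x y ↔
    ∀ i, IsLevel i x → IsLevel i y → IsLevel i z ∧ red i z = red i x + red i y := Iff.rfl

/-! ### Absolute value, metric and norm of the truncated field. -/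

/-- The absolute value `|u π ^ n| = 2 ^ (-n)`. -/
noncomputable def absVal : TruncatedField D → ℝ
  | zero => 0
  | monomial _ n => (1 / 2) ^ n

lemma absVal_zero : absVal (0 : TruncatedField D) = 0 := rfl

lemma absVal_monomial (u : Rˣ) (n : ℤ) :
    absVal (monomial u n : TruncatedField D) = (1 / 2) ^ n := rfl

lemma absVal_nonneg (x : TruncatedField D) : 0 ≤ absVal x := by
  cases x
  · exact le_rfl
  · rw [absVal_monomial]; positivity

lemma absVal_le_iff {x : TruncatedField D} {i : ℤ} : absVal x ≤ (1 / 2) ^ i ↔ IsLevel i x := by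
  cases x with
  | zero =>
    exact iff_of_true (show (0 : ℝ) ≤ _ by positivity) trivial
  | monomial u n =>
    rw [absVal_monomial, isLevel_monomial,
      zpow_le_zpow_iff_right_of_lt_one₀ (by norm_num) (by norm_num)]

lemma absVal_eq_zero_iff (x : TruncatedField D) : absVal x = 0 ↔ x = 0 := by
  cases x with
  | zero => exact iff_of_true rfl rfl
  | monomial u n =>
    refine iff_of_false ?_ (monomial_ne_zero u n)
    rw [absVal_monomial]
    positivity

lemma absVal_le_absVal {x y : TruncatedField D} (h : ∀ i, IsLevel i y → IsLevel i x) :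
    absVal x ≤ absVal y := by
  cases y with
  | zero =>
    cases x with
    | zero => exact le_rfl
    | monomial u n => exact absurd (isLevel_monomial.1 (h (n + 1) trivial)) (by omega)
  | monomial v n =>
    rw [absVal_monomial, absVal_le_iff]
    exact h n (isLevel_monomial.2 le_rfl)

lemma max_absVal {x y : TruncatedField D} {n : ℤ} (hx : IsLevel n x) (hy : IsLevel n y)
    (hn : ∀ i, IsLevel i x → IsLevel i y → i ≤ n) : max (absVal x) (absVal y) = (1 / 2) ^ n := by
  refine le_antisymm (max_le (absVal_le_iff.2 hx) (absVal_le_iff.2 hy)) ?_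
  by_contra! hlt
  rw [max_lt_iff] at hlt
  have key : ∀ {z : TruncatedField D}, absVal z < (1 / 2) ^ n → IsLevel (n + 1) z := by
    intro z hz
    cases z with
    | zero => trivial
    | monomial u m =>
      rw [absVal_monomial, zpow_lt_zpow_iff_right_of_lt_one₀ (by norm_num) (by norm_num)] at hz
      exact isLevel_monomial.2 hz
  exact absurd (hn (n + 1) (key hlt.1) (key hlt.2)) (by omega)

/-- If zero is not in the sum, the reductions have nonzero sum at some common level. All elements of
`x + y` share this nonzero reduction, hence have the same levels. -/
lemma absVal_eq_of_zero_notMem {x y z w : TruncatedField D} (h : 0 ∉ hadd x y)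
    (hz : z ∈ hadd x y) (hw : w ∈ hadd x y) : absVal z = absVal w := by
  rw [mem_hadd] at h hz hw
  push Not at h
  obtain ⟨i, hx, hy, h⟩ := h
  have h0 : red i x + red i y ≠ 0 := fun h' => h (isLevel_zero i) (by rw [h', red_zero])
  obtain ⟨hz, hzr⟩ := hz i hx hy
  obtain ⟨hw, hwr⟩ := hw i hx hy
  exact le_antisymm
    (absVal_le_absVal fun j hj => isLevel_of_red_eq hz hw (hzr.trans hwr.symm) (hzr ▸ h0) hj)
    (absVal_le_absVal fun j hj => isLevel_of_red_eq hw hz (hwr.trans hzr.symm) (hwr ▸ h0) hj)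

/-- This identifies balls with fibres of the reduction at level `i`; the ball axiom and the
reduction maps of the triple both follow from it. -/
lemma hyperDist_absVal_le_iff {x y : TruncatedField D} {i : ℤ} (hx : IsLevel i x) :
    hyperDist absVal x y ≤ (1 / 2) ^ (i + D.length) ↔ IsLevel i y ∧ red i x = red i y := by
  by_cases hxy : x = y
  · subst hxy
    rw [hyperDist, if_pos rfl]
    exact iff_of_true (by positivity) ⟨hx, rfl⟩
  obtain ⟨w, hw⟩ := sum_nonempty x (-y)
  -- The general `hyperDist_eq` presupposes the valued structure under construction, so the distance
  -- is computed directly.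
  have hd : hyperDist absVal x y = absVal w := by
    have himg : absVal '' hadd x (-y) = {absVal w} := by
      refine Set.eq_singleton_iff_unique_mem.2 ⟨⟨w, hw, rfl⟩, ?_⟩
      rintro _ ⟨z, hz, rfl⟩
      refine absVal_eq_of_zero_notMem (fun h0 => hxy ?_) hz hw
      have := eq_neg_of_zero_mem_sum h0
      rw [← neg_neg_eq y, this, neg_neg_eq]
    rw [hyperDist, if_neg hxy, himg, csSup_singleton]
  rw [hd, absVal_le_iff]
  constructor
  · intro hl
    have hyx : y ∈ sum x (-w) := by
      rw [mem_sum_neg_iff, sum_comm]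
      exact mem_sum_neg_iff.1 hw
    have hwi : IsLevel i w := hl.mono (by omega)
    obtain ⟨hy, hyr⟩ := hyx i hx (isLevel_neg.2 hwi)
    rw [red_neg, hwi.red_eq_zero_iff.2 hl, neg_zero, add_zero] at hyr
    exact ⟨hy, hyr.symm⟩
  · rintro ⟨hy, hyr⟩
    obtain ⟨hwi, hwr⟩ := hw i hx (isLevel_neg.2 hy)
    rw [← hwi.red_eq_zero_iff, hwr, red_neg, hyr, add_neg_cancel]

lemma sumsAreBalls_absVal :
    SumsAreBalls (absVal : TruncatedField D → ℝ) ((1 / 2) ^ D.length) := by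
  refine Or.inl fun x y => ?_
  obtain ⟨c, hc⟩ := sum_nonempty x y
  refine ⟨c, ?_⟩
  ext z
  rw [hyperClosedBall, Set.mem_ofPred_eq]
  by_cases h0 : x = 0 ∧ y = 0
  · obtain ⟨rfl, rfl⟩ := h0
    rw [sum_zero] at hc
    obtain rfl : c = 0 := hc
    rw [hadd_zero, Set.mem_singleton_iff, absVal_zero, max_self, mul_zero]
    constructor
    · rintro rfl
      rw [hyperDist, if_pos rfl]
    · intro h
      -- A distance at most zero is below every radius, so the reductions agree at every level.
      refine eq_of_red_eq fun i _ _ => ?_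
      rw [← ((hyperDist_absVal_le_iff (isLevel_zero i)).1 (h.trans (by positivity))).2]
  · obtain ⟨n, hx, hy, hn⟩ := exists_max_level h0
    obtain ⟨hcl, hcr⟩ := hc n hx hy
    rw [max_absVal hx hy hn, ← zpow_natCast, ← zpow_add₀ (by norm_num), add_comm,
      hyperDist_absVal_le_iff hcl]
    constructor
    · intro h
      obtain ⟨h1, h2⟩ := h n hx hy
      exact ⟨h1, hcr.trans h2.symm⟩
    · rintro ⟨h1, h2⟩
      exact mem_sum_of_max_level hx hy hn h1 (h2 ▸ hcr)

noncomputable instance : ValuedHyperfield (TruncatedField D) where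
  val := absVal
  val_nonneg := absVal_nonneg
  val_eq_zero_iff := absVal_eq_zero_iff
  val_mul x y := by
    cases x with
    | zero => exact (zero_mul _).symm
    | monomial u m =>
      cases y with
      | zero => exact (mul_zero _).symm
      | monomial v n =>
        rw [monomial_mul_monomial, absVal_monomial, absVal_monomial, absVal_monomial,
          zpow_add₀ (by norm_num)]
  val_le_max x y z hz := by
    by_cases h0 : x = 0 ∧ y = 0
    · obtain ⟨rfl, rfl⟩ := h0
      rw [hadd_zero] at hz
      obtain rfl : z = 0 := hz
      exact le_max_left _ _
    · obtain ⟨n, hx, hy, hn⟩ := exists_max_level h0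
      rw [max_absVal hx hy hn, absVal_le_iff]
      exact (hz n hx hy).1
  val_eq_of_zero_notMem _ _ h _ hz _ hw := absVal_eq_of_zero_notMem h hz hw
  sumsAreBalls := ⟨_, by positivity, sumsAreBalls_absVal⟩

lemma val_le_iff {x : TruncatedField D} {i : ℤ} : val x ≤ (1 / 2) ^ i ↔ IsLevel i x :=
  absVal_le_iff

lemma val_monomial (u : Rˣ) (n : ℤ) : val (monomial u n : TruncatedField D) = (1 / 2) ^ n := rfl

variable (D)

lemma isDiscretelyValued : IsDiscretelyValued (TruncatedField D) := by
  rintro _ ⟨x, rfl⟩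
  rw [accPt_iff_nhds]
  cases x with
  | zero =>
    refine iff_of_true (fun U hU => ?_) rfl
    obtain ⟨ε, hε, hb⟩ := Metric.mem_nhds_iff.1 hU
    obtain ⟨n, hn⟩ := exists_pow_lt_of_lt_one hε (show (1 / 2 : ℝ) < 1 by norm_num)
    have hv : val (monomial 1 n : TruncatedField D) = (1 / 2) ^ n := by
      rw [val_monomial, zpow_natCast]
    refine ⟨_, ⟨hb ?_, monomial 1 n, hv⟩, ?_⟩
    · rw [Metric.mem_ball]
      change dist _ (0 : ℝ) < ε
      rwa [Real.dist_eq, sub_zero, abs_of_pos (by positivity)]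
    · change _ ≠ (0 : ℝ)
      positivity
  | monomial u n =>
    refine iff_of_false (fun h => ?_) (by rw [val_monomial]; positivity)
    rw [val_monomial] at h
    have hpos : (0 : ℝ) < (1 / 2) ^ n := by positivity
    -- Half the value is a safe radius: a power of `1 / 2` within it of `(1 / 2) ^ n` has an
    -- exponent strictly between `n - 1` and `n + 1`.
    obtain ⟨_, ⟨hy, y, rfl⟩, hne⟩ := h _ (Metric.ball_mem_nhds _ (half_pos hpos))
    rw [Metric.mem_ball, Real.dist_eq, abs_lt] at hy
    cases y with
    | zero =>
      change _ < (0 : ℝ) - _ ∧ _ at hy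
      linarith [hy.1]
    | monomial v m =>
      rw [val_monomial] at hy hne
      have h1 : (1 / 2 : ℝ) ^ (n + 1) < (1 / 2) ^ m := by
        rw [zpow_add_one₀ (by norm_num)]; linarith [hy.1]
      have h2 : (1 / 2 : ℝ) ^ (m + 1) < (1 / 2) ^ n := by
        rw [zpow_add_one₀ (by norm_num)]; linarith [hy.2]
      rw [zpow_lt_zpow_iff_right_of_lt_one₀ (by norm_num) (by norm_num)] at h1 h2
      exact hne (by rw [show m = n by omega])

lemma theta_eq : theta (TruncatedField D) = 1 / 2 := by
  refine IsGreatest.csSup_eq ⟨⟨by norm_num, monomial 1 1, monomial_ne_zero _ _, by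
    rw [val_monomial, zpow_one]⟩, ?_⟩
  rintro _ ⟨ha, x, hx, rfl⟩
  cases x with
  | zero => exact absurd rfl hx
  | monomial u n =>
    rw [← zpow_one (1 / 2 : ℝ), val_le_iff, isLevel_monomial]
    have ha : (1 / 2 : ℝ) ^ n < (1 / 2) ^ (0 : ℤ) := ha.trans_eq (zpow_zero _).symm
    rw [zpow_lt_zpow_iff_right_of_lt_one₀ (by norm_num) (by norm_num)] at ha
    omega

lemma mem_hadd_one_neg_one_iff {x : TruncatedField D} :
    x ∈ hadd 1 (-1) ↔ val x ≤ (1 / 2) ^ (D.length : ℤ) := by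
  rw [val_le_iff]
  have h1 : IsLevel 0 (1 : TruncatedField D) := isLevel_monomial.2 le_rfl
  constructor
  · intro h
    obtain ⟨hx, hxr⟩ := h 0 h1 (isLevel_neg.2 h1)
    rw [red_neg, add_neg_cancel, hx.red_eq_zero_iff, zero_add] at hxr
    exact hxr
  · intro h
    have hx : IsLevel 0 x := h.mono (by omega)
    refine mem_sum_of_max_level h1 (isLevel_neg.2 h1) (fun i hi _ => hi) hx ?_
    rw [red_neg, add_neg_cancel, hx.red_eq_zero_iff, zero_add]
    exact h

/-- Both numbers are radii of the same ball `1 - 1` around `0`, and both occur as absolute values,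
so each bounds the other. -/
lemma krasnerNorm_eq : krasnerNorm (TruncatedField D) = (1 / 2) ^ (D.length : ℤ) := by
  have hd := isDiscretelyValued D
  obtain ⟨k, -, hk, -⟩ := hd.exists_krasnerNorm_eq_pow
  rw [theta_eq, ← zpow_natCast] at hk
  have h : ∀ x : TruncatedField D,
      val x ≤ krasnerNorm (TruncatedField D) ↔ val x ≤ (1 / 2) ^ (D.length : ℤ) := by
    intro x
    rw [← mem_hadd_one_neg_one_iff, hd.mem_sub_self_iff, hyp_val_one, mul_one]
  refine le_antisymm ?_ ?_
  · have := (h (monomial 1 k)).1 (by rw [hk, val_monomial])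
    rwa [val_monomial, ← hk] at this
  · have := (h (monomial 1 D.length)).2 (by rw [val_monomial])
    rwa [val_monomial] at this

lemma not_isSingleValued : ¬ Hyperfield.IsSingleValued (TruncatedField D) := by
  intro h
  obtain ⟨z, hz⟩ := h 1 (-1)
  have h0 : (0 : TruncatedField D) ∈ hadd 1 (-1) := zero_mem_hadd_neg _
  have h1 : (monomial 1 D.length : TruncatedField D) ∈ hadd 1 (-1) :=
    (mem_hadd_one_neg_one_iff D).2 (by rw [val_monomial])
  rw [hz] at h0 h1
  exact monomial_ne_zero _ _ (Eq.trans h1 (Eq.symm h0))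

/-- The discretely valued hyperfield of a truncated discrete valuation ring. -/
noncomputable def dvHyp : DVHyp.{u} where
  carrier := TruncatedField D
  discretelyValued := isDiscretelyValued D
  not_field := not_isSingleValued D

variable {D}

lemma mem_integers_iff {x : TruncatedField D} : x ∈ integers (TruncatedField D) ↔ IsLevel 0 x := by
  rw [mem_integers, ← val_le_iff, zpow_zero]

lemma mem_maxIdeal_iff {x : TruncatedField D} : x ∈ maxIdeal (TruncatedField D) ↔ IsLevel 1 x := by
  rw [mem_maxIdeal, ← val_le_iff, zpow_one, theta_eq]

lemma congrMod_iff {x y : TruncatedField D} {i : ℤ} (hx : IsLevel i x) (hy : IsLevel i y) :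
    congrMod ((1 / 2) ^ (i + D.length)) x y ↔ red i x = red i y :=
  (hyperDist_absVal_le_iff hx).trans (and_iff_right hy)

end TruncatedField

end TruncatedField

/-! ### Realization of a triple by a truncated field. -/

namespace Triple

lemma exists_truncatedUniformizer (T : Triple.{u}) {x : T.M}
    (hx : Function.Bijective fun a : T.R => a • x) :
    ∃ D : TruncatedUniformizer T.R, D.t = T.ε x := by
  classical
  have hmax : IsLocalRing.maximalIdeal T.R = Ideal.span {T.ε x} := by
    rw [← T.range_ε]
    ext a
    rw [LinearMap.mem_range, Ideal.mem_span_singleton']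
    constructor
    · rintro ⟨m, rfl⟩
      obtain ⟨b, rfl⟩ := hx.2 m
      exact ⟨b, (map_smul T.ε b x).symm⟩
    · rintro ⟨b, rfl⟩
      exact ⟨b • x, map_smul T.ε b x⟩
  have hnil : ∃ n, T.ε x ^ n = 0 := by
    obtain ⟨n, hn⟩ := (isArtinianRing_iff_isNilpotent_maximalIdeal T.R).1 inferInstance
    rw [hmax, Ideal.span_singleton_pow] at hn
    exact ⟨n, Ideal.span_singleton_eq_bot.1 hn⟩
  exact ⟨⟨T.ε x, hmax, Nat.find hnil, fun n => ⟨Nat.find_min' hnil, fun h =>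
    pow_eq_zero_of_le h (Nat.find_spec hnil)⟩⟩, rfl⟩

open TruncatedField in
/-- Every triple is the triple of a discretely valued hyperfield. -/
lemma exists_tripleReduction (T : Triple.{u}) :
    ∃ H : DVHyp.{u}, Nonempty (TripleReduction H.carrier T) := by
  obtain ⟨π, hπ⟩ := T.exists_generator
  obtain ⟨D, hD⟩ := T.exists_truncatedUniformizer hπ
  have hI : ∀ x : integers (TruncatedField D), IsLevel 0 (x : TruncatedField D) :=
    fun x => mem_integers_iff.1 x.2
  have hM : ∀ x : maxIdeal (TruncatedField D), IsLevel 1 (x : TruncatedField D) :=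
    fun x => mem_maxIdeal_iff.1 x.2
  let p : TripleReduction (TruncatedField D) T :=
    { redR := fun x => red 0 (x : TruncatedField D)
      redR_surjective := fun a => by
        obtain ⟨x, hx, hxa⟩ := exists_red_eq (D := D) 0 a
        exact ⟨⟨x, mem_integers_iff.2 hx⟩, hxa⟩
      redR_eq_iff := fun x y => by
        rw [krasnerNorm_eq, ← congrMod_iff (hI x) (hI y), zero_add]
      redR_add := fun x y z h => (h 0 (hI x) (hI y)).2
      redR_mul := fun x y z h => by
        have := ((hI x).mul (hI y)).2
        rwa [zero_add, ← h] at this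
      redR_one := fun x h => by
        rw [h]
        exact (red_monomial_self _ _).trans Units.val_one
      -- Elements of the maximal ideal are read at level `1`, with the generator `π` of `M` standing
      -- for the removed uniformizer.
      redM := fun x => red 1 (x : TruncatedField D) • π
      redM_surjective := fun m => by
        obtain ⟨a, rfl⟩ := hπ.2 m
        obtain ⟨x, hx, hxa⟩ := exists_red_eq (D := D) 1 a
        exact ⟨⟨x, mem_maxIdeal_iff.2 hx⟩, congrArg (· • π) hxa⟩
      redM_eq_iff := fun x y => by
        rw [theta_eq, krasnerNorm_eq, ← zpow_one_add₀ (by norm_num), congrMod_iff (hM x) (hM y)]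
        exact hπ.1.eq_iff
      redM_add := fun x y z h => by
        rw [← add_smul, (h 1 (hM x) (hM y)).2]
      redM_smul := fun a x y h => by
        have := ((hI a).mul (hM x)).2
        rw [zero_add, ← h] at this
        rw [this, mul_smul]
      ε_redM := fun x y h => by
        -- Passing from level `1` to level `0` multiplies by `t`, and `t` was chosen to be `ε π`.
        rw [map_smul, smul_eq_mul, ← h, (hM x).red_eq zero_le_one, ← hD, mul_comm, sub_zero,
          Int.toNat_one, pow_one] }
  exact ⟨dvHyp D, ⟨p⟩⟩

end Triple

theorem mainTheorem1 :
    ∃ (Tr : DVHyp.{u} ⥤ Triple.{u}) (p : ∀ H : DVHyp.{u}, TripleReduction H.carrier (Tr.obj H)),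
      (∀ (H H' : DVHyp.{u}) (f : H ⟶ H'), IsInducedBy (p H) (p H') f (Tr.map f)) ∧
      Tr.Faithful ∧ Tr.EssSurj := by
  refine ⟨DVHyp.tripleFunctor, fun H => H.tripleReduction,
    fun H H' f => isInducedBy_inducedHom _ _ _, ⟨fun {H H' f g} h => ?_⟩, ⟨fun T => ?_⟩⟩
  · refine (isInducedBy_inducedHom H.tripleReduction H'.tripleReduction f).eq_of_eq ?_
    exact (congrArg (IsInducedBy H.tripleReduction H'.tripleReduction g) h).mpr
      (isInducedBy_inducedHom _ _ _)
  -- Both `T` and `Tr(H)` are reductions of the same hyperfield, and such triples are isomorphic.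
  · obtain ⟨H, ⟨p⟩⟩ := T.exists_tripleReduction
    exact ⟨H, ⟨H.tripleReduction.iso p⟩⟩
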